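/- Let $n\ge 3$ be an odd integer. For non-zero integers $B,C$ write $B=f^2B_0$ with $f\ge 1$ and $B_0$ squarefree, and let $\mathcal Y_{B,C}(\mathbb Z)$ be the set of primitive integer solutions $(x,y,z)$, $\gcd(x,y,z)=1$, of $x^2+By^2=Cz^n$. Put $K=\mathbb Q(\sqrt{-B_0})$ and $u=x+f\sqrt{-B_0}\,y$. A solution is of type $*^0$ if $u\notin p\mathcal O_K$ for all primes $p$; it is of type $\tilde *^0$ if $u\notin p\mathcal O_K$ for all odd primes $p$, $u\in 2\mathcal O_K\setminus 4\mathcal O_K$ and $x$ is odd. Let $\mathbb E$ be the set of pairs of non-zero integers $(B,C)$ such that for some prime $p\mid n$ one has $v_p(f)>v_p(C)/2$ and moreover $v_p(f)-v_p(C)/2\ge n$ if $v_p(C)$ is even, $v_p(f)-v_p(C)/2\ge \frac{n+1}{2}$ if $v_p(C)$ is odd. Then $\mathbb E$ has a natural density in $\mathbb Z^2$, and it is at most $\sum_{p\mid n}p^{-(p+1)/2}$. Let $(B,C)\notin\mathbb E$ with $B,C\neq 0$ and $-B$ not a square. Let $g$ be the largest integer with $g^2\mid\gcd(B,C)$ and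 $(B_1,C_1)=(B/g^2,C/g^2)$, $B_1=f_1^2B_0$. For a prime $p$ put $r_p=v_p(f_1)$, $c_p=v_p(C_1)$. Consider the families $(s_p)_p$ of non-negative integers such that for every prime $p$: if $r_p=0$, then $2s_p\le c_p$; if $r_p>0$, then either $s_p=c_p=0$, or $0<s_p\le r_p$ and ($s_p=r_p$ or $n\mid 2s_p-c_p$). (So $s_p=0$ whenever $p\nmid f_1C_1$.) Attach to such a family $$B'=B_1\prod_{p\mid f_1}p^{-2s_p},\qquad C'=C_1\prod_{p\mid f_1,\ s_p>0}p^{\,n\lceil (2s_p-c_p)/n\rceil-2s_p}\prod_{p\nmid f_1}p^{-2s_p},\qquad N=\prod_{p\mid f_1,\ s_p>0}p,\qquad M=\prod_{p\nmid f_1,\ s_p>0}p ,$$ write $B'=f'^2B_0'$ with $f'\ge1$ and $B'_0$ squarefree, and take the type $*^0$, and also the type $\tilde *^0$ provided that $B_0'\equiv 3\pmod 4$, $f'$ is odd and, in case $M$ is even, $4\parallel C'$ if $B_0'\equiv 3\pmod 8$ and $8\mid C'$ if $B_0'\equiv 7\pmod 8$. Each pair $D$ consisting of such a family and such a type defines the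 set $S_D\subseteq\mathcal Y_{B',C'}(\mathbb Z)$ of the solutions of that type with $\gcd(y,N)=1$ and $\gcd(z,M)=1$. Let $\mathcal P$ be the set of all pairs $(B',C')$ so obtained, and let $S_{B',C'}$ be the union of the sets $S_D$ over all $D$ with target $(B',C')$. Then: 1. $\mathcal P$ is finite, and every $(B',C')\in\mathcal P$ satisfies $B',C'\ne0$, $B'_0=B_0$ and $\gcd(f',C')=1$. 2. $\mathcal Y_{B,C}(\mathbb Z)\neq\emptyset$ if and only if $S_{B',C'}\ne\emptyset$ for some $(B',C')\in\mathcal P$. 3. If there is no prime $p\mid\gcd(n,B_0)$ with $2v_p(f)=v_p(C)+n$, then for every $D$ the set $S_D$ is non-empty if and only if for all integers $m\ge1$ (only for all odd $m\geq 1$ if the type is $\tilde *^0$, $B_0\equiv7\pmod 8$ and $8\nmid C'$) there is a solution of the type of $D$ in $\mathcal Y_{B',C'}(\mathbb Z)$ with $\gcd(z,m)=1$. -/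

import Mathlib

open Filter Topology

namespace GenFermat

/-! ### Square part and squarefree part: `B = f ^ 2 * B₀` -/

/-- The largest natural number `f` with `f ^ 2 ∣ B` (for `B ≠ 0`). -/
def sqPart (B : ℤ) : ℕ :=
  Nat.findGreatest (fun d => d ^ 2 ∣ B.natAbs) B.natAbs

/-- The squarefree integer `B₀` with `B = f ^ 2 * B₀`, where `f = sqPart B` (for `B ≠ 0`). -/
def sqfPart (B : ℤ) : ℤ :=
  B / (sqPart B : ℤ) ^ 2

/-! ### Integral points -/

/-- The primitive integer solutions `(x, y, z)` of `x ^ 2 + B * y ^ 2 = C * z ^ n`: the primitive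
representatives `[x : y : z]` of the integral points of the stacky curve attached to the
equation. -/
def Points (n : ℕ) (B C : ℤ) : Set (ℤ × ℤ × ℤ) :=
  {P | Int.gcd (Int.gcd P.1 P.2.1) P.2.2 = 1 ∧ P.1 ^ 2 + B * P.2.1 ^ 2 = C * P.2.2 ^ n}

/-- `ℚ(√-B₀)`, as the `ℚ`-algebra `ℚ[ω]` with `ω ^ 2 = -B₀`, where `B₀` is the squarefree part
of `B`. -/
abbrev QuadField (B : ℤ) : Type :=
  QuadraticAlgebra ℚ (-(sqfPart B : ℚ)) 0

/-- The element `u = x + f √-B₀ y`. -/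
def uElt (B x y : ℤ) : QuadField B :=
  ⟨(x : ℚ), (sqPart B : ℚ) * (y : ℚ)⟩

/-- `x + f √-B₀ y ∈ m 𝓞_K`, where `𝓞_K` is the ring of algebraic integers of
`K = ℚ(√-B₀)`. -/
def MemMulInt (B : ℤ) (m : ℕ) (x y : ℤ) : Prop :=
  ∃ w : QuadField B, w ∈ integralClosure ℤ (QuadField B) ∧ uElt B x y = (m : ℚ) • w

/-- The condition `*_p^r`: `p ^ r` exactly divides `x + f √-B₀ y` in `𝓞_K`. -/
def Star (B : ℤ) (p r : ℕ) (P : ℤ × ℤ × ℤ) : Prop :=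
  MemMulInt B (p ^ r) P.1 P.2.1 ∧ ¬ MemMulInt B (p ^ (r + 1)) P.1 P.2.1

/-- The condition `*~_2^r`: `2 ^ (r + 1)` exactly divides `x + f √-B₀ y` in `𝓞_K` and `2 ^ r`
exactly divides `x`. -/
def TildeStarTwo (B : ℤ) (r : ℕ) (P : ℤ × ℤ × ℤ) : Prop :=
  Star B 2 (r + 1) P ∧ (2 : ℤ) ^ r ∣ P.1 ∧ ¬ (2 : ℤ) ^ (r + 1) ∣ P.1

/-- The two types of base case. -/
inductive Kind
  | star
  | tilde

/-- The condition `*^0` (for `Kind.star`), resp. `*~^0` (for `Kind.tilde`). -/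
def BaseCond (B : ℤ) : Kind → ℤ × ℤ × ℤ → Prop
  | Kind.star, P => ∀ p : ℕ, p.Prime → Star B p 0 P
  | Kind.tilde, P => TildeStarTwo B 0 P ∧ ∀ p : ℕ, p.Prime → p ≠ 2 → Star B p 0 P

/-- The points of type `*^0` (resp. `*~^0`) with `gcd(y, N) = 1` and `gcd(z, M) = 1`. -/
def BasePoints (n : ℕ) (B C : ℤ) (κ : Kind) (N M : ℕ) : Set (ℤ × ℤ × ℤ) :=
  {P | P ∈ Points n B C ∧ BaseCond B κ P ∧ Int.gcd P.2.1 N = 1 ∧ Int.gcd P.2.2 M = 1}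

/-! ### The excluded set and its density -/

/-- The excluded set: pairs of nonzero integers `(B, C)`, `B = f ^ 2 * B₀`, such that for some
prime `p ∣ n` one has `v_p(f) > v_p(C) / 2` and moreover `v_p(f) - v_p(C) / 2 ≥ n` if `v_p(C)` is
even, `v_p(f) - v_p(C) / 2 ≥ (n + 1) / 2` if `v_p(C)` is odd. -/
def Excluded (n : ℕ) : Set (ℤ × ℤ) :=
  {Q | Q.1 ≠ 0 ∧ Q.2 ≠ 0 ∧ ∃ p : ℕ, p.Prime ∧ p ∣ n ∧
    (padicValInt p Q.2 : ℚ) / 2 < padicValNat p (sqPart Q.1) ∧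
    (Even (padicValInt p Q.2) →
      (n : ℚ) ≤ padicValNat p (sqPart Q.1) - (padicValInt p Q.2 : ℚ) / 2) ∧
    (Odd (padicValInt p Q.2) →
      ((n : ℚ) + 1) / 2 ≤ padicValNat p (sqPart Q.1) - (padicValInt p Q.2 : ℚ) / 2)}

/-- The set `E` of pairs of integers has natural density `δ`: the proportion of the pairs `(B, C)`
with `|B|, |C| ≤ T` that lie in `E` tends to `δ` as `T → ∞`. -/
def HasNaturalDensity (E : Set (ℤ × ℤ)) (δ : ℝ) : Prop :=
  Tendsto (fun T : ℕ =>
    ((E ∩ (Set.Icc (-(T : ℤ)) T ×ˢ Set.Icc (-(T : ℤ)) T)).ncard : ℝ) / (2 * (T : ℝ) + 1) ^ 2)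
    atTop (𝓝 δ)

/-! ### The cascade -/

/-- First step: the largest `g` with `g ^ 2 ∣ gcd(B, C)`. -/
def commonSq (B C : ℤ) : ℕ :=
  sqPart (Int.gcd B C : ℤ)

/-- `B / g ^ 2`. -/
def redB (B C : ℤ) : ℤ :=
  B / (commonSq B C : ℤ) ^ 2

/-- `C / g ^ 2`. -/
def redC (B C : ℤ) : ℤ :=
  C / (commonSq B C : ℤ) ^ 2

/-- The local condition at the prime `p` on the exponent `s` of the largest power of `p` dividing
both `x` and `f y`, for a pair `(B, C)` such that `gcd(B, C)` is squarefree.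
With `r = v_p(f)` and `c = v_p(C)` (so `c ≤ 1` if `r > 0`):
* if `r = 0`, then `s ≤ ⌊c / 2⌋`;
* if `r > 0`, then either `s = 0` and `c = 0`, or `0 < s ≤ r` and (`s = r` or `n ∣ 2 s - c`). -/
def LocalExp (n : ℕ) (B C : ℤ) (p s : ℕ) : Prop :=
  (padicValNat p (sqPart B) = 0 ∧ 2 * s ≤ padicValInt p C) ∨
  (0 < padicValNat p (sqPart B) ∧
    ((s = 0 ∧ padicValInt p C = 0) ∨
      (0 < s ∧ s ≤ padicValNat p (sqPart B) ∧
        (s = padicValNat p (sqPart B) ∨ n ∣ 2 * s - padicValInt p C))))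

/-- The primes dividing both `d` and `f`. -/
def primesOfF (B : ℤ) (d : ℕ) : Finset ℕ :=
  d.primeFactors.filter (fun p => p ∣ sqPart B)

/-- The primes dividing `d` but not `f`. -/
def primesOffF (B : ℤ) (d : ℕ) : Finset ℕ :=
  d.primeFactors.filter (fun p => ¬ p ∣ sqPart B)

/-- `∏ p ^ s_p` over the primes `p ∣ f`, where `s_p = v_p(d)`. -/
def fFactor (B : ℤ) (d : ℕ) : ℕ :=
  ∏ p ∈ primesOfF B d, p ^ padicValNat p d

/-- `∏ p ^ ⌈(2 s_p - v_p(C)) / n⌉` over the primes `p ∣ gcd(d, f)`, where `s_p = v_p(d)`. -/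
def zFactor (n : ℕ) (B C : ℤ) (d : ℕ) : ℕ :=
  ∏ p ∈ primesOfF B d, p ^ ((2 * padicValNat p d - padicValInt p C) ⌈/⌉ n)

/-- The new coefficient of `y ^ 2`: it is `B * ∏_{p ∣ f} p ^ (-2 s_p)`. -/
def newB (B : ℤ) (d : ℕ) : ℤ :=
  B / (fFactor B d : ℤ) ^ 2

/-- The new coefficient of `z ^ n`: it is
`C * ∏_{p ∣ f, s_p > 0} p ^ (⌈(2 s_p - v_p(C)) / n⌉ n - 2 s_p) * ∏_{p ∤ f} p ^ (-2 s_p)`. -/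
def newC (n : ℕ) (B C : ℤ) (d : ℕ) : ℤ :=
  C * (zFactor n B C d : ℤ) ^ n / (d : ℤ) ^ 2

/-- The modulus to which `y` has to be coprime: the product of the primes `p ∣ f` with
`s_p > 0`. -/
def yMod (B : ℤ) (d : ℕ) : ℕ :=
  ∏ p ∈ primesOfF B d, p

/-- The modulus to which `z` has to be coprime: the product of the primes `p ∤ f` with
`s_p > 0`. -/
def zMod (B : ℤ) (d : ℕ) : ℕ :=
  ∏ p ∈ primesOffF B d, p

/-- The moduli `M` for which points with `z` coprime to `M` are considered: any `M ≥ 1`, except that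
`M` has to be odd in the case `*~^0` when `B₀ ≡ 7 (mod 8)` and `8 ∤ C`
(there `z` is always even). -/
def AllowedModulus (B C : ℤ) (κ : Kind) (M : ℕ) : Prop :=
  0 < M ∧ (κ = Kind.tilde → sqfPart B ≡ 7 [ZMOD 8] → ¬ (8 : ℤ) ∣ C → Odd M)

/-- The types of points to be considered on the curve with coefficients `(B', C')`: always `*^0`;
and `*~^0` if `B₀ ≡ 3 (mod 4)`, `f'` is odd and, in case `z` is required to be odd, `4 ∥ C'` if
`B₀ ≡ 3 (mod 8)` and `8 ∣ C'` if `B₀ ≡ 7 (mod 8)`. -/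
def KindOK (B' C' : ℤ) (M : ℕ) : Kind → Prop
  | Kind.star => True
  | Kind.tilde => sqfPart B' ≡ 3 [ZMOD 4] ∧ Odd (sqPart B') ∧
      (Even M → (sqfPart B' ≡ 3 [ZMOD 8] ∧ (4 : ℤ) ∣ C' ∧ ¬ (8 : ℤ) ∣ C') ∨
        (sqfPart B' ≡ 7 [ZMOD 8] ∧ (8 : ℤ) ∣ C'))

/-- The cascade data of a pair `(B, C)` with `gcd(B, C)` squarefree: a positive integer
`d = ∏ p ^ s_p` recording an admissible exponent at each prime, and a type. -/
def RedData (n : ℕ) (B C : ℤ) : Set (ℕ × Kind) :=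
  {D | 0 < D.1 ∧ (∀ p : ℕ, p.Prime → LocalExp n B C p (padicValNat p D.1)) ∧
    KindOK (newB B D.1) (newC n B C D.1) (zMod B D.1) D.2}

/-- The cascade data of an arbitrary pair `(B, C)`. -/
def Data (n : ℕ) (B C : ℤ) : Set (ℕ × Kind) :=
  RedData n (redB B C) (redC B C)

/-- The pair `(B', C')` attached to a cascade datum. -/
def targetPair (n : ℕ) (B C : ℤ) (D : ℕ × Kind) : ℤ × ℤ :=
  (newB (redB B C) D.1, newC n (redB B C) (redC B C) D.1)

/-- The finite set `𝒫` of pairs `(B', C')`. -/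
def cascadePairs (n : ℕ) (B C : ℤ) : Set (ℤ × ℤ) :=
  targetPair n B C '' Data n B C

/-- The points of the curve with coefficients `(B', C')` singled out by one cascade datum. -/
def datumPoints (n : ℕ) (B C : ℤ) (D : ℕ × Kind) : Set (ℤ × ℤ × ℤ) :=
  BasePoints n (targetPair n B C D).1 (targetPair n B C D).2 D.2
    (yMod (redB B C) D.1) (zMod (redB B C) D.1)

/-- The set `S_{B', C'}`: the union of the sets attached to the cascade data with target
`(B', C')`. -/
def cascadeSet (n : ℕ) (B C : ℤ) (Q : ℤ × ℤ) : Set (ℤ × ℤ × ℤ) :=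
  {P | ∃ D ∈ Data n B C, targetPair n B C D = Q ∧ P ∈ datumPoints n B C D}

/-- A borderline pair: some prime `p ∣ gcd(n, B₀)` has `v_p(f) = (v_p(C) + n) / 2`. -/
def Borderline (n : ℕ) (B C : ℤ) : Prop :=
  ∃ p : ℕ, p.Prime ∧ p ∣ n ∧ (p : ℤ) ∣ sqfPart B ∧
    2 * padicValNat p (sqPart B) = padicValInt p C + n

end GenFermat

/-!
Write `K = ℚ(√-B₀)` and `u = x + y √-B`, so that the equation reads `N(u) = C z ^ n`.

*Integrality.* An element of `K` is integral exactly if its trace and norm are integers. Hence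
`u ∈ m 𝓞_K` means `m ∣ 2 x` and `m ^ 2 ∣ x ^ 2 + B y ^ 2` (`memMulInt_iff`), and the types `*^0`,
`*~^0` become congruence conditions on `x` and `y`.

*The cascade.* After removing the common square factor of `B` and `C`, a primitive solution is
divided by `d = gcd(x, f y)`. Comparing valuations in `x ^ 2 + B y ^ 2 = C z ^ n` at each prime gives
the admissible exponents of `d` (`localExp_gcd`) and a point attached to a cascade datum
(`exists_basePoints_of_points`); multiplying by `d` leads back (`points_nonempty_of_basePoints`).

*Moving points.* For the third assertion, `u` is multiplied by the `n`-th power of an element of `K`,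
which changes `z` but not `C`. If `z` is coprime to the discriminant of the order and `u` is not
divisible by any rational prime, then `u` is locally, at the primes dividing `z`, a unit times the
`n`-th power of an ideal of norm `z` and a factor of norm `C`. Replacing this ideal by another one
in its class amounts to choosing a value of a primitive binary quadratic form, and such a form takes
values coprime to any given modulus, with arguments prescribed modulo finitely many primes
(`exists_primitive_norm_eq`). For the type `*^0` the order is `ℤ[√-B]`; for the type `*~^0` it
is `ℤ[(1 + √-B) / 2]`, and `u / 2` is moved (`exists_star_point`, `exists_tilde_point`).
The freedom in the local factors also makes `y` coprime to `N`: an `n`-th power can be irrational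
modulo `p`, unless `p` divides both `n` and `B'` (`exists_pow_irrational`). In that case, outside the
excluded set and the borderline pairs, `p ∣ C'` (`dvd_newC_of_dvd_yMod`), so that `p ∣ x` and `p ∤ y`.

*Density.* The excluded set is determined by valuations at the primes `p ∣ n`. Up to pairs in
which `p ^ K` divides a coordinate, it is a union of residue classes; these exceptions have
small density for large `K`. The bound holds as `p ^ ((p + 1) / 2) ∣ B` for an excluded pair.
-/

namespace GenFermat

section

open QuadraticAlgebra

/-! ### Moving a primitive element of a quadratic order by an `n`-th power -/

theorem intCast_dvd_iff {a b : ℤ} {k : ℤ} {v : QuadraticAlgebra ℤ a b} :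
    (k : QuadraticAlgebra ℤ a b) ∣ v ↔ k ∣ v.re ∧ k ∣ v.im := by
  have := QuadraticAlgebra.algebraMap_dvd_iff (a := a) (b := b) (r := k) (z := v)
  simpa using this

theorem dvd_of_dvd_intCast_mul {a b : ℤ} {p : ℕ} (hp : p.Prime) {k : ℤ} (hk : ¬ (p : ℤ) ∣ k)
    {v : QuadraticAlgebra ℤ a b}
    (h : ((p : ℤ) : QuadraticAlgebra ℤ a b) ∣ (k : QuadraticAlgebra ℤ a b) * v) :
    ((p : ℤ) : QuadraticAlgebra ℤ a b) ∣ v := by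
  have hp' := Nat.prime_iff_prime_int.1 hp
  rw [intCast_dvd_iff] at h ⊢
  simp only [re_mul, im_mul, re_intCast, im_intCast, mul_zero, zero_mul, add_zero] at h
  exact ⟨(hp'.dvd_or_dvd h.1).resolve_left hk, (hp'.dvd_or_dvd h.2).resolve_left hk⟩

/-- An element of a quadratic order is primitive if no rational prime divides it. -/
def Primitive {a b : ℤ} (v : QuadraticAlgebra ℤ a b) : Prop :=
  ∀ p : ℕ, p.Prime → ¬ (((p : ℤ) : QuadraticAlgebra ℤ a b) ∣ v)

theorem exists_int_modEq (S : Finset ℕ) (hS : ∀ p ∈ S, p.Prime) (c : ℕ → ℤ) :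
    ∃ x : ℤ, ∀ p ∈ S, (p : ℤ) ∣ x - c p := by
  obtain ⟨r, hr⟩ := IsDedekindDomain.exists_forall_sub_mem_ideal (R := ℤ) (s := S)
    (fun p => Ideal.span {(p : ℤ)}) (fun _ => 1)
    (fun i hi => by
      have := (Nat.prime_iff_prime_int.1 (hS i hi))
      exact (Ideal.span_singleton_prime this.ne_zero).2 this |> Ideal.prime_of_isPrime
        (by simpa using this.ne_zero))
    (fun i hi j hj hij h => hij (by
      have := Ideal.span_singleton_eq_span_singleton.1 h
      have := Int.natAbs_eq_iff_associated.2 this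
      simpa using this)) (fun i => c i)
  exact ⟨r, fun p hp => by simpa [Ideal.mem_span_singleton] using hr p hp⟩

/-- A coprime pair of integers can be prescribed modulo finitely many primes. -/
theorem exists_coprime_modEq (S : Finset ℕ) (hS : ∀ p ∈ S, p.Prime) (c e : ℕ → ℤ)
    (h : ∀ p ∈ S, ¬ ((p : ℤ) ∣ c p ∧ (p : ℤ) ∣ e p)) :
    ∃ x y : ℤ, (∀ p : ℕ, p.Prime → ¬ ((p : ℤ) ∣ x ∧ (p : ℤ) ∣ y)) ∧
      ∀ p ∈ S, (p : ℤ) ∣ x - c p ∧ (p : ℤ) ∣ y - e p := by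
  obtain ⟨y, hy0, hy⟩ : ∃ y : ℤ, y ≠ 0 ∧ ∀ p ∈ S, (p : ℤ) ∣ y - e p := by
    obtain ⟨y, hy⟩ := exists_int_modEq S hS e
    by_cases hy0 : y = 0
    · refine ⟨∏ p ∈ S, (p : ℤ), Finset.prod_ne_zero_iff.2 fun p hp => ?_, fun p hp => ?_⟩
      · exact_mod_cast (hS p hp).ne_zero
      · have := (hy p hp)
        rw [hy0, zero_sub, dvd_neg] at this
        exact dvd_sub (Finset.dvd_prod_of_mem _ hp) this
    · exact ⟨y, hy0, hy⟩
  obtain ⟨x, hx⟩ := exists_int_modEq (S ∪ y.natAbs.primeFactors)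
    (fun p hp => by
      rcases Finset.mem_union.1 hp with hp | hp
      · exact hS p hp
      · exact Nat.prime_of_mem_primeFactors hp) (fun p => if p ∈ S then c p else 1)
  refine ⟨x, y, ?_, fun p hp => ⟨?_, hy p hp⟩⟩
  · rintro p hp ⟨h1, h2⟩
    by_cases hpS : p ∈ S
    · have h3 := hx p (Finset.mem_union_left _ hpS)
      rw [if_pos hpS] at h3
      exact h p hpS ⟨(dvd_sub_right h1).1 h3, (dvd_sub_right h2).1 (hy p hpS)⟩
    · have hm : p ∈ y.natAbs.primeFactors :=
        Nat.mem_primeFactors.2 ⟨hp, Int.natCast_dvd.1 h2, by simpa using hy0⟩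
      have h3 := hx p (Finset.mem_union_right _ hm)
      rw [if_neg hpS] at h3
      have h4 := (dvd_sub_right h1).1 h3
      exact hp.one_lt.ne' (by simpa using Int.natAbs_dvd_natAbs.2 h4)
  · simpa [hp] using hx p (Finset.mem_union_left _ hp)

theorem gcd_eq_one_iff_forall_prime {x y : ℤ} :
    Int.gcd x y = 1 ↔ ∀ p : ℕ, p.Prime → ¬ ((p : ℤ) ∣ x ∧ (p : ℤ) ∣ y) := by
  rw [Nat.eq_one_iff_not_exists_prime_dvd]
  refine forall₂_congr fun p _ => not_congr ?_
  rw [← Int.natCast_dvd_natCast, Int.dvd_coe_gcd_iff]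

theorem isCoprime_iff_forall_prime {x y : ℤ} :
    IsCoprime x y ↔ ∀ p : ℕ, p.Prime → ¬ ((p : ℤ) ∣ x ∧ (p : ℤ) ∣ y) := by
  rw [Int.isCoprime_iff_gcd_eq_one, gcd_eq_one_iff_forall_prime]

/-- If `v` and `z` are as in the equation `N(v) = A z ^ n`, then `v` is congruent modulo `z ^ n`
to a rational multiple of `t + ω`, where `z ^ n ∣ N(t + ω)`. -/
theorem exists_root_mod {a b A z : ℤ} {n : ℕ} (hn : n ≠ 0) {v : QuadraticAlgebra ℤ a b}
    (hv : Primitive v) (hN : norm v = A * z ^ n) :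
    ∃ t l : ℤ, v.re = t * v.im + z ^ n * l ∧ z ^ n ∣ t ^ 2 + b * t - a := by
  rw [norm_def] at hN
  have hco : IsCoprime v.im (z ^ n) := by
    refine IsCoprime.pow_right (isCoprime_iff_forall_prime.2 ?_)
    rintro p hp ⟨h1, h2⟩
    refine hv p hp (intCast_dvd_iff.2 ⟨?_, h1⟩)
    have hp' := Nat.prime_iff_prime_int.1 hp
    refine or_self_iff.1 (hp'.dvd_or_dvd ?_)
    have h3 : (p : ℤ) ∣ A * z ^ n := (dvd_pow h2 hn).mul_left _
    have h4 : v.re * v.re = A * z ^ n - v.im * (b * v.re - a * v.im) := by rw [← hN]; ring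
    exact h4 ▸ dvd_sub h3 (h1.mul_right _)
  obtain ⟨k, l, hkl⟩ := hco
  have hre : v.re = v.re * k * v.im + z ^ n * (l * v.re) := by linear_combination -v.re * hkl
  refine ⟨v.re * k, l * v.re, hre, ?_⟩
  have hco' : IsCoprime (z ^ n) (v.im ^ 2) := (IsCoprime.pow_left ⟨k, l, hkl⟩).symm
  refine hco'.dvd_of_dvd_mul_left ?_
  generalize v.re * k = t at *
  refine ⟨A - l * v.re * (2 * v.im * t + z ^ n * (l * v.re) + b * v.im), ?_⟩
  linear_combination hN + (-(v.re) - t * v.im - z ^ n * (l * v.re) - b * v.im) * hre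

/-- A primitive element whose norm is divisible by a prime not dividing the discriminant has only
primitive powers at that prime. -/
theorem not_dvd_pow {a b : ℤ} {p : ℕ} (hp : p.Prime) (hD : ¬ (p : ℤ) ∣ b ^ 2 + 4 * a)
    {g : QuadraticAlgebra ℤ a b} (hg : ¬ ((p : ℤ) : QuadraticAlgebra ℤ a b) ∣ g)
    (hNg : (p : ℤ) ∣ norm g) (n : ℕ) (hn : n ≠ 0) :
    ¬ ((p : ℤ) : QuadraticAlgebra ℤ a b) ∣ g ^ n := by
  have hp' := Nat.prime_iff_prime_int.1 hp
  have htr : ¬ (p : ℤ) ∣ trace g := by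
    intro ht
    refine hg (intCast_dvd_iff.2 ?_)
    have h1 : (p : ℤ) ∣ (b ^ 2 + 4 * a) * (g.im * g.im) := by
      have : (b ^ 2 + 4 * a) * (g.im * g.im) = trace g * trace g - 4 * norm g := by
        rw [trace_def, norm_def]; ring
      exact this ▸ dvd_sub (ht.mul_right _) (hNg.mul_left _)
    have h2 : (p : ℤ) ∣ g.im := or_self_iff.1 (hp'.dvd_or_dvd ((hp'.dvd_or_dvd h1).resolve_left hD))
    refine ⟨or_self_iff.1 (hp'.dvd_or_dvd ?_), h2⟩
    have : g.re * g.re = norm g - g.im * (b * g.re - a * g.im) := by rw [norm_def]; ring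
    exact this ▸ dvd_sub hNg (h2.mul_right _)
  have key : ∀ k : ℕ, ((p : ℤ) : QuadraticAlgebra ℤ a b) ∣ g ^ (k + 1) - (trace g ^ k : ℤ) * g := by
    intro k
    induction k with
    | zero => simp
    | succ k ih =>
      have hsq : g ^ 2 = (trace g : ℤ) * g - (norm g : ℤ) := by
        rw [sq_eq_trace_smul_sub_norm]; simp
      have hd : ((p : ℤ) : QuadraticAlgebra ℤ a b) ∣ (norm g : ℤ) := Int.cast_dvd_cast _ _ hNg
      have : g ^ (k + 1 + 1) - (trace g ^ (k + 1) : ℤ) * g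
          = g * (g ^ (k + 1) - (trace g ^ k : ℤ) * g) - (trace g ^ k : ℤ) * (norm g : ℤ) := by
        push_cast
        linear_combination (((trace g : ℤ) : QuadraticAlgebra ℤ a b)) ^ k * hsq
      rw [this]
      exact dvd_sub (ih.mul_left _) (hd.mul_left _)
  obtain ⟨k, rfl⟩ := Nat.exists_eq_succ_of_ne_zero hn
  intro h
  exact hg (dvd_of_dvd_intCast_mul hp (fun h => htr (hp'.dvd_of_dvd_pow h))
    ((dvd_sub_right h).1 (key k)))

/-- Let `v` be a primitive element of a quadratic order with `N(v) = A z ^ n`, where `z` is coprime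
to the discriminant. Then `v` can be multiplied by the `n`-th power of an element of the field so
that `z` becomes coprime to a given `T` and the factor is prescribed modulo the primes `p ∣ T`,
`p ∤ z`. The factor is `(γ / z) ^ n`, where `γ` runs through a lattice of index `z` (the conjugate
of an ideal of norm `z` whose `n`-th power divides `v`), on which `N(γ) / z` is a primitive binary
quadratic form. -/
theorem exists_primitive_norm_eq {a b A z : ℤ} {n : ℕ} (hn : 2 ≤ n) {v : QuadraticAlgebra ℤ a b}
    (hv : Primitive v) (hN : norm v = A * z ^ n) (hz : z ≠ 0) (hA : A ≠ 0)
    (hD0 : b ^ 2 + 4 * a ≠ 0) (hD : ∀ p : ℕ, p.Prime → (p : ℤ) ∣ z → ¬ (p : ℤ) ∣ b ^ 2 + 4 * a)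
    {T : ℕ} (hT : T ≠ 0) (g : ℕ → QuadraticAlgebra ℤ a b)
    (hg : ∀ p : ℕ, p.Prime → p ∣ T → ¬ (p : ℤ) ∣ z → ¬ (p : ℤ) ∣ norm (g p)) :
    ∃ (v' : QuadraticAlgebra ℤ a b) (z' : ℤ), norm v' = A * z' ^ n ∧ Primitive v' ∧
      (∀ p : ℕ, p.Prime → p ∣ T → ¬ (p : ℤ) ∣ z') ∧
      ∀ p : ℕ, p.Prime → p ∣ T → ¬ (p : ℤ) ∣ z →
        ((p : ℤ) : QuadraticAlgebra ℤ a b) ∣ v' - v * g p ^ n := by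
  classical
  have hn0 : n ≠ 0 := by omega
  obtain ⟨t, l, hre, q, hq⟩ := exists_root_mod hn0 hv hN
  obtain ⟨m, rfl⟩ : ∃ m, n = m + 2 := ⟨n - 2, by omega⟩
  -- the primes of `A`, `D` and `z` are also kept under control
  set T' : ℕ := T * (A * (b ^ 2 + 4 * a) * z).natAbs with hT'
  have hT'0 : T' ≠ 0 := by simp [hT', hT, hA, hD0, hz]
  set g' : ℕ → QuadraticAlgebra ℤ a b := fun p => if p ∣ T then g p else 1 with hg'
  have hgn : ∀ p : ℕ, p.Prime → ¬ (p : ℤ) ∣ z → ¬ (p : ℤ) ∣ norm (g' p) := by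
    intro p hp hpz
    by_cases hpT : p ∣ T
    · simpa [hg', hpT] using hg p hp hpT hpz
    · simpa [hg', hpT] using (Nat.prime_iff_prime_int.1 hp).not_dvd_one
  -- `F` is the binary quadratic form `N(c z + e (t + b - ω)) / z`, `G` the element
  set F : ℤ → ℤ → ℤ := fun c e => c ^ 2 * z + c * e * (2 * t + b) + e ^ 2 * (z ^ (m + 1) * q) with hF
  set G : ℤ → ℤ → QuadraticAlgebra ℤ a b := fun c e => ⟨c * z + e * (t + b), -e⟩ with hG
  have hGF : ∀ c e, norm (G c e) = z * F c e := by
    intro c e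
    simp only [hG, hF, norm_def]
    linear_combination e ^ 2 * hq
  -- local choices: `F(1, 1)` is prime to `p` if `p ∣ z`; otherwise `γ` is taken to be `z * g p`
  set c₀ : ℕ → ℤ := fun p => if (p : ℤ) ∣ z then 1 else (g' p).re + (g' p).im * (t + b) with hc₀
  set e₀ : ℕ → ℤ := fun p => if (p : ℤ) ∣ z then 1 else - z * (g' p).im with he₀
  have hloc : ∀ p : ℕ, p.Prime → ¬ (p : ℤ) ∣ F (c₀ p) (e₀ p) := by
    intro p hp h
    have hp' := Nat.prime_iff_prime_int.1 hp
    by_cases hpz : (p : ℤ) ∣ z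
    · simp only [hc₀, he₀, hF, if_pos hpz] at h
      refine hD p hp hpz ?_
      have h1 : (p : ℤ) ∣ 2 * t + b := by
        have : 2 * t + b = (1 ^ 2 * z + 1 * 1 * (2 * t + b) + 1 ^ 2 * (z ^ (m + 1) * q))
          - z * (1 + z ^ m * q) := by ring
        exact this ▸ dvd_sub h (hpz.mul_right _)
      have : b ^ 2 + 4 * a = (2 * t + b) * (2 * t + b) - z * (4 * z ^ (m + 1) * q) := by
        linear_combination -4 * hq
      exact this ▸ dvd_sub (h1.mul_right _) (hpz.mul_right _)
    · have h1 : norm (G (c₀ p) (e₀ p)) = z ^ 2 * norm (g' p) := by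
        simp only [hG, hc₀, he₀, if_neg hpz, norm_def]
        ring
      rw [hGF] at h1
      have h2 : F (c₀ p) (e₀ p) = z * norm (g' p) := mul_left_cancel₀ hz (by rw [h1]; ring)
      rw [h2] at h
      exact (hp'.dvd_or_dvd h).elim hpz (hgn p hp hpz)
  obtain ⟨c, e, hce, hceT⟩ := exists_coprime_modEq T'.primeFactors
    (fun p hp => Nat.prime_of_mem_primeFactors hp) c₀ e₀ (by
      rintro p hp ⟨h1, h2⟩
      refine hloc p (Nat.prime_of_mem_primeFactors hp) ?_
      have : F (c₀ p) (e₀ p) = c₀ p * (c₀ p * z + e₀ p * (2 * t + b))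
        + e₀ p * (e₀ p * (z ^ (m + 1) * q)) := by simp only [hF]; ring
      exact this ▸ dvd_add (h1.mul_right _) (h2.mul_right _))
  have hz'T : ∀ p : ℕ, p.Prime → p ∣ T' → ¬ (p : ℤ) ∣ F c e := by
    intro p hp hpT h
    obtain ⟨h1, h2⟩ := hceT p (Nat.mem_primeFactors.2 ⟨hp, hpT, hT'0⟩)
    refine hloc p hp ?_
    have : F (c₀ p) (e₀ p) = F c e - (c - c₀ p) * ((c + c₀ p) * z + e * (2 * t + b))
        - (e - e₀ p) * (c₀ p * (2 * t + b) + (e + e₀ p) * (z ^ (m + 1) * q)) := by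
      simp only [hF]; ring
    exact this ▸ dvd_sub (dvd_sub h (h1.mul_right _)) (h2.mul_right _)
  set γ := G c e with hγ
  set n := m + 2 with hnm
  have hzinj : ∀ w w' : QuadraticAlgebra ℤ a b, ((z : ℤ) : QuadraticAlgebra ℤ a b) ^ n * w
      = (z : QuadraticAlgebra ℤ a b) ^ n * w' → w = w' := by
    intro w w' h
    have hzn : z ^ n ≠ 0 := pow_ne_zero _ hz
    rw [← Int.cast_pow] at h
    have h1 := congrArg QuadraticAlgebra.re h
    have h2 := congrArg QuadraticAlgebra.im h
    simp only [re_mul, im_mul, re_intCast, im_intCast, mul_zero, zero_mul, add_zero] at h1 h2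
    exact QuadraticAlgebra.ext (mul_left_cancel₀ hzn h1) (mul_left_cancel₀ hzn h2)
  -- `v` is congruent to a multiple of `t + ω` modulo `z ^ n`, and `γ ^ n` to a multiple of its conjugate
  obtain ⟨v', hv'⟩ : ((z : ℤ) : QuadraticAlgebra ℤ a b) ^ n ∣ v * γ ^ n := by
    have h1 : ((z : ℤ) : QuadraticAlgebra ℤ a b) ^ n ∣ v * ⟨t + b, -1⟩ := by
      rw [← Int.cast_pow, intCast_dvd_iff]
      simp only [re_mul, im_mul]
      rw [hre]
      refine ⟨⟨v.im * q + l * (t + b), ?_⟩, ⟨-l, by ring⟩⟩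
      linear_combination v.im * hq
    have h2 : γ = (c : QuadraticAlgebra ℤ a b) * z + (e : ℤ) * ⟨t + b, -1⟩ := by
      ext <;> simp [hγ, hG]
    obtain ⟨δ, hδ⟩ := sub_dvd_pow_sub_pow γ ((c : QuadraticAlgebra ℤ a b) * z) n
    have h3 : v * γ ^ n = (v * ⟨t + b, -1⟩) * (e * δ) + (z : QuadraticAlgebra ℤ a b) ^ n * (c ^ n * v) := by
      rw [show γ ^ n = (γ - c * z) * δ + (c * z) ^ n by rw [← hδ]; ring, h2]
      ring
    exact h3 ▸ dvd_add (h1.mul_right _) (dvd_mul_right _ _)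
  have hNv' : norm v' = A * F c e ^ n := by
    have h := congrArg QuadraticAlgebra.norm hv'
    rw [map_mul, map_mul, map_pow, map_pow, hN, hγ, hGF, norm_intCast, Int.cast_id] at h
    refine mul_left_cancel₀ (pow_ne_zero n (pow_ne_zero 2 hz)) (h.symm.trans ?_)
    rw [mul_pow, ← pow_mul, mul_comm 2 n, pow_mul]
    ring
  have hback : star γ ^ n * v' = ((F c e : ℤ) : QuadraticAlgebra ℤ a b) ^ n * v := by
    apply hzinj
    have h1 : γ * star γ = ((z * F c e : ℤ) : QuadraticAlgebra ℤ a b) := by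
      rw [← hGF, ← algebraMap_norm_eq_mul_star]; simp [hγ]
    calc (z : QuadraticAlgebra ℤ a b) ^ n * (star γ ^ n * v')
        = (v * γ ^ n) * star γ ^ n := by rw [hv']; ring
      _ = v * (γ * star γ) ^ n := by ring
      _ = _ := by rw [h1]; push_cast; ring
  refine ⟨v', F c e, hNv', ?_, fun p hp hpT => hz'T p hp (hpT.mul_right _), ?_⟩
  · intro p hp hpv'
    have hp' := Nat.prime_iff_prime_int.1 hp
    by_cases hpz' : (p : ℤ) ∣ F c e
    -- at a new prime, `v` is invertible, and a power of the primitive element `γ` is primitive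
    · have hpT' : ¬ p ∣ T' := fun h => hz'T p hp h hpz'
      have hpAD : ¬ (p : ℤ) ∣ A * (b ^ 2 + 4 * a) * z :=
        fun h => hpT' ((Int.natCast_dvd.1 h).mul_left _)
      have hpz : ¬ (p : ℤ) ∣ z := fun h => hpAD (h.mul_left _)
      have hpA : ¬ (p : ℤ) ∣ A := fun h => hpAD ((h.mul_right _).mul_right _)
      have hpD : ¬ (p : ℤ) ∣ b ^ 2 + 4 * a := fun h => hpAD ((h.mul_left _).mul_right _)
      refine not_dvd_pow hp hpD (g := γ) ?_ ?_ n hn0 ?_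
      · rw [intCast_dvd_iff]
        rintro ⟨h1, h2⟩
        simp only [hγ, hG, dvd_neg] at h1 h2
        have h3 := (dvd_add_left (h2.mul_right _)).1 h1
        exact hce p hp ⟨(hp'.dvd_or_dvd h3).resolve_right hpz, h2⟩
      · rw [hγ, hGF]; exact hpz'.mul_left _
      · have h1 : ((p : ℤ) : QuadraticAlgebra ℤ a b) ∣ ((norm v : ℤ) : QuadraticAlgebra ℤ a b) * γ ^ n := by
          have h2 : ((norm v : ℤ) : QuadraticAlgebra ℤ a b) = v * star v := by
            rw [← algebraMap_norm_eq_mul_star]; simp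
          rw [h2, show v * star v * γ ^ n = star v * (v * γ ^ n) by ring, hv']
          exact (hpv'.mul_left _).mul_left _
        refine dvd_of_dvd_intCast_mul hp ?_ h1
        rw [hN]
        exact fun h => (hp'.dvd_or_dvd h).elim hpA fun h => hpz (hp'.dvd_of_dvd_pow h)
    · refine hv p hp ?_
      have h1 := hpv'.mul_left (star γ ^ n)
      rw [hback, ← Int.cast_pow] at h1
      exact dvd_of_dvd_intCast_mul hp (fun h => hpz' (hp'.dvd_of_dvd_pow h)) h1
  · intro p hp hpT hpz
    have hp' := Nat.prime_iff_prime_int.1 hp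
    obtain ⟨h1, h2⟩ := hceT p (Nat.mem_primeFactors.2 ⟨hp, hpT.mul_right _, hT'0⟩)
    simp only [hc₀, he₀, if_neg hpz, hg', if_pos hpT] at h1 h2
    have h3 : ((p : ℤ) : QuadraticAlgebra ℤ a b) ∣ γ - z * g p := by
      rw [intCast_dvd_iff]
      simp only [hγ, hG, re_sub, im_sub, re_mul, im_mul, re_intCast, im_intCast, mul_zero, zero_mul,
        add_zero]
      constructor
      · have : c * z + e * (t + b) - z * (g p).re = (c - ((g p).re + (g p).im * (t + b))) * z
          + (e - -z * (g p).im) * (t + b) := by ring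
        exact this ▸ dvd_add (h1.mul_right _) (h2.mul_right _)
      · have : -e - z * (g p).im = -(e - -z * (g p).im) := by ring
        exact this ▸ (dvd_neg.2 h2)
    have h4 : ((p : ℤ) : QuadraticAlgebra ℤ a b) ∣ (z ^ n : ℤ) * (v' - v * g p ^ n) := by
      have h5 := (h3.trans (sub_dvd_pow_sub_pow _ _ n)).mul_left v
      rw [mul_sub, hv'] at h5
      convert h5 using 1
      push_cast
      ring
    exact dvd_of_dvd_intCast_mul hp (fun h => hpz (hp'.dvd_of_dvd_pow h)) h4

/-! ### Divisibility in the ring of integers -/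

theorem sqPart_sq_dvd (B : ℤ) : (sqPart B : ℤ) ^ 2 ∣ B := by
  rcases eq_or_ne B 0 with rfl | hB
  · simp
  · have h := Nat.findGreatest_spec (P := fun d => d ^ 2 ∣ B.natAbs) (m := 1) (n := B.natAbs)
      (Nat.one_le_iff_ne_zero.2 (by simpa using hB)) (by simp)
    rw [← Int.natCast_pow, Int.natCast_dvd]
    exact h

theorem sqPart_sq_mul_sqfPart (B : ℤ) : (sqPart B : ℤ) ^ 2 * sqfPart B = B :=
  Int.mul_ediv_cancel' (sqPart_sq_dvd B)

/-- An element of `ℚ(√-B₀)` is integral exactly if its trace and its norm are integers. -/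
theorem mem_integralClosure_quadField_iff {B : ℤ} (w : QuadField B) :
    w ∈ integralClosure ℤ (QuadField B) ↔
      (∃ t : ℤ, (t : ℚ) = 2 * w.re) ∧ ∃ m : ℤ, (m : ℚ) = w.re ^ 2 + sqfPart B * w.im ^ 2 := by
  have hint : ∀ q : ℚ, IsIntegral ℤ (⟨q, 0⟩ : QuadField B) → ∃ t : ℤ, (t : ℚ) = q := by
    intro q hq
    have h1 : IsIntegral ℤ (algebraMap ℚ (QuadField B) q) := hq
    rw [isIntegral_algebraMap_iff QuadraticAlgebra.algebraMap_injective] at h1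
    exact IsIntegrallyClosed.isIntegral_iff.1 h1
  rw [_root_.mem_integralClosure_iff]
  constructor
  · intro h
    have hs : IsIntegral ℤ (star w) := by
      obtain ⟨P, hP, hPw⟩ := h
      refine ⟨P, hP, ?_⟩
      have := congrArg star hPw
      rw [star_zero] at this
      rw [← this, ← Polynomial.aeval_def, ← Polynomial.aeval_def]
      simp [Polynomial.aeval_eq_sum_range]
    constructor
    · refine hint _ ?_
      have := h.add hs
      convert this using 1
      ext <;> simp; ring
    · refine hint _ ?_
      have := h.mul hs
      convert this using 1
      ext <;> simp <;> ring
  · rintro ⟨⟨t, ht⟩, ⟨m, hm⟩⟩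
    refine ⟨Polynomial.X ^ 2 - Polynomial.C t * Polynomial.X + Polynomial.C m, ?_, ?_⟩
    · monicity!
    · simp only [Polynomial.eval₂_add, Polynomial.eval₂_sub, Polynomial.eval₂_mul, Polynomial.eval₂_pow, Polynomial.eval₂_X, Polynomial.eval₂_C]
      ext
      · simp [pow_two, ht, hm]
        ring
      · simp [pow_two, ht]
        ring

theorem memMulInt_iff {B : ℤ} {m : ℕ} (hm : m ≠ 0) (x y : ℤ) :
    MemMulInt B m x y ↔ (m : ℤ) ∣ 2 * x ∧ (m : ℤ) ^ 2 ∣ x ^ 2 + B * y ^ 2 := by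
  have hm' : (m : ℚ) ≠ 0 := by exact_mod_cast hm
  have hB : (sqPart B : ℚ) ^ 2 * sqfPart B = B := by exact_mod_cast sqPart_sq_mul_sqfPart B
  have h1 : MemMulInt B m x y ↔
      (⟨x / m, sqPart B * y / m⟩ : QuadField B) ∈ integralClosure ℤ (QuadField B) := by
    constructor
    · rintro ⟨w, hw, h⟩
      convert hw using 1
      have h1 := congrArg QuadraticAlgebra.re h
      have h2 := congrArg QuadraticAlgebra.im h
      simp only [uElt, re_smul, im_smul, smul_eq_mul] at h1 h2
      ext
      · simp only [h1]; field_simp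
      · simp only [h2]; field_simp
    · intro h
      refine ⟨_, h, ?_⟩
      ext <;> simp only [uElt, re_smul, im_smul, smul_eq_mul] <;> field_simp
  rw [h1, mem_integralClosure_quadField_iff]
  refine and_congr ⟨?_, ?_⟩ ⟨?_, ?_⟩
  · rintro ⟨t, ht⟩
    refine ⟨t, ?_⟩
    field_simp at ht
    have : (m : ℚ) * t = 2 * x := by linarith
    exact_mod_cast this.symm
  · rintro ⟨t, ht⟩
    have : (2 * x : ℚ) = m * t := by exact_mod_cast ht
    refine ⟨t, ?_⟩
    field_simp
    linarith
  · rintro ⟨t, ht⟩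
    refine ⟨t, ?_⟩
    field_simp at ht
    have : (x : ℚ) ^ 2 + B * y ^ 2 = m ^ 2 * t := by rw [← hB]; linarith
    exact_mod_cast this
  · rintro ⟨t, ht⟩
    have : (x : ℚ) ^ 2 + B * y ^ 2 = m ^ 2 * t := by exact_mod_cast ht
    refine ⟨t, ?_⟩
    rw [← hB] at this
    field_simp
    linarith

theorem star_zero_iff {B : ℤ} {p : ℕ} (hp : p.Prime) (P : ℤ × ℤ × ℤ) :
    Star B p 0 P ↔ ¬ ((p : ℤ) ∣ 2 * P.1 ∧ (p : ℤ) ^ 2 ∣ P.1 ^ 2 + B * P.2.1 ^ 2) := by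
  rw [Star, memMulInt_iff (by simp), memMulInt_iff (by simp [hp.ne_zero])]
  simp

theorem tildeStarTwo_iff {B : ℤ} (P : ℤ × ℤ × ℤ) :
    TildeStarTwo B 0 P ↔ (4 : ℤ) ∣ P.1 ^ 2 + B * P.2.1 ^ 2 ∧ ¬ (2 : ℤ) ∣ P.1 := by
  rw [TildeStarTwo, Star, memMulInt_iff (by simp), memMulInt_iff (by simp)]
  norm_num
  intro h1 _ h2
  omega

/-! ### Moving points on the curve -/

/-- For odd `n`, some `n`-th power of a unit of `ℤ[√-B]` modulo `p` has a nonzero coefficient at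
`√-B`, unless `p` divides both `n` and `B`: the element `√-B` itself works if `p ∤ B`, and `1 + √-B`
works if `p ∣ B`. -/
theorem exists_pow_irrational {B : ℤ} {n : ℕ} (hn : Odd n) {p : ℕ} (hp : p.Prime)
    (h : (p : ℤ) ∣ B → ¬ p ∣ n) {R : Type*} [CommRing R] {r : R} (hr : r ^ 2 = -(B : R)) :
    ∃ α β P Q : ℤ, ¬ (p : ℤ) ∣ α ^ 2 + B * β ^ 2 ∧ ¬ (p : ℤ) ∣ Q ∧
      ((p : ℤ) : R) ∣ (α + β * r) ^ n - (P + Q * r) := by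
  have hp' := Nat.prime_iff_prime_int.1 hp
  by_cases hpB : (p : ℤ) ∣ B
  · refine ⟨1, 1, 1, n, fun h1 => ?_, fun h1 => h hpB (by exact_mod_cast h1), ?_⟩
    · exact hp'.not_dvd_one (by simpa using (dvd_add_left (hpB.mul_right _)).1 h1)
    · obtain ⟨k, hk⟩ := Polynomial.powAddExpansion 1 r n
      have : (((1 : ℤ) : R) + (1 : ℤ) * r) ^ n - ((1 : ℤ) + ((n : ℤ) : R) * r) = (B : R) * -k := by
        push_cast
        rw [one_mul, hk, hr]
        ring
      exact this ▸ (Int.cast_dvd_cast _ _ hpB).mul_right _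
  · obtain ⟨j, rfl⟩ := hn
    refine ⟨0, 1, 0, (-B) ^ j, by simpa using hpB,
      fun h1 => hpB ((dvd_neg).1 (hp'.dvd_of_dvd_pow h1)), ?_⟩
    have : (((0 : ℤ) : R) + (1 : ℤ) * r) ^ (2 * j + 1) - ((0 : ℤ) + (((-B) ^ j : ℤ) : R) * r) = 0 := by
      push_cast
      rw [← hr]
      ring
    rw [this]
    exact dvd_zero _

/-- Moving a solution of the type `*^0`, stated by congruences: `z` becomes coprime to `M`, and `y`
coprime to `N`. Here `z` is automatically coprime to `2 B`, hence to the
discriminant `-4 B`. -/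
theorem exists_star_point {n : ℕ} (hn : Odd n) (hn3 : 3 ≤ n) {B C : ℤ} (hB : B ≠ 0) (hC : C ≠ 0)
 {x y z : ℤ} (heq : x ^ 2 + B * y ^ 2 = C * z ^ n)
    (hst : ∀ p : ℕ, p.Prime → ¬ ((p : ℤ) ∣ 2 * x ∧ (p : ℤ) ^ 2 ∣ x ^ 2 + B * y ^ 2)) {M N : ℕ}
    (hM : M ≠ 0) (hN : N ≠ 0) (hNz : ∀ p : ℕ, p.Prime → p ∣ N → p ≠ 2 → ¬ (p : ℤ) ∣ z)
    (hNn : ∀ p : ℕ, p.Prime → p ∣ N → (p : ℤ) ∣ B → p ∣ n → (p : ℤ) ∣ C) :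
    ∃ x' y' z' : ℤ, x' ^ 2 + B * y' ^ 2 = C * z' ^ n ∧
      (∀ p : ℕ, p.Prime → ¬ ((p : ℤ) ∣ 2 * x' ∧ (p : ℤ) ^ 2 ∣ x' ^ 2 + B * y' ^ 2)) ∧
      (∀ p : ℕ, p.Prime → p ∣ M → ¬ (p : ℤ) ∣ z') ∧ ∀ p : ℕ, p.Prime → p ∣ N → ¬ (p : ℤ) ∣ y' := by
  classical
  have hxy : ∀ p : ℕ, p.Prime → (p : ℤ) ∣ x → (p : ℤ) ∣ y → False := fun p hp h1 h2 =>
    hst p hp ⟨h1.mul_left _, dvd_add (pow_dvd_pow_of_dvd h1 2) ((pow_dvd_pow_of_dvd h2 2).mul_left _)⟩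
  have hdvd : ∀ {p : ℕ}, (p : ℤ) ∣ z → (p : ℤ) ^ 2 ∣ C * z ^ n := fun {p} h =>
    ((pow_dvd_pow_of_dvd h 2).trans (pow_dvd_pow z (by omega))).mul_left _
  have hz2 : ∀ p : ℕ, p.Prime → (p : ℤ) ∣ 2 → ¬ (p : ℤ) ∣ z := fun p hp h2 h =>
    hst p hp ⟨h2.mul_right _, heq ▸ hdvd h⟩
  have hz : z ≠ 0 := by
    rintro rfl
    exact hz2 2 Nat.prime_two (by norm_num) (dvd_zero _)
  have hzB : ∀ p : ℕ, p.Prime → (p : ℤ) ∣ z → ¬ (p : ℤ) ∣ B := fun p hp h hpB => by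
    have h1 : (p : ℤ) ∣ x ^ 2 :=
      (dvd_add_left (hpB.mul_right _)).1 (heq ▸ (dvd_pow h (by omega)).mul_left C)
    exact hst p hp ⟨((Nat.prime_iff_prime_int.1 hp).dvd_of_dvd_pow h1).mul_left _, heq ▸ hdvd h⟩
  -- the element `v = x + y √-B` of the order `ℤ[√-B]`
  have hω : (omega : QuadraticAlgebra ℤ (-B) 0) ^ 2 = -((B : ℤ) : QuadraticAlgebra ℤ (-B) 0) := by
    ext <;> simp [pow_two]
  -- the local factors, chosen so that `y` becomes prime to `p` for `p ∣ N`
  have key : ∀ p : ℕ, ∃ g : QuadraticAlgebra ℤ (-B) 0, p.Prime → ¬ (p : ℤ) ∣ z →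
      ¬ (p : ℤ) ∣ norm g ∧ (p ∣ N → ¬ (p : ℤ) ∣ ((⟨x, y⟩ : QuadraticAlgebra ℤ (-B) 0) * g ^ n).im) := by
    intro p
    by_cases hp : p.Prime ∧ p ∣ N ∧ (p : ℤ) ∣ y
    · obtain ⟨hp, hpN, hpy⟩ := hp
      have hp' := Nat.prime_iff_prime_int.1 hp
      have hpx : ¬ (p : ℤ) ∣ x := fun h => hxy p hp h hpy
      have hBn : (p : ℤ) ∣ B → ¬ p ∣ n := fun h1 h2 => hpx <| hp'.dvd_of_dvd_pow (n := 2) <|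
        (dvd_add_left (h1.mul_right _)).1 (heq ▸ (hNn p hp hpN h1 h2).mul_right _)
      obtain ⟨α, β, P, Q, h1, h2, h3⟩ := exists_pow_irrational hn hp hBn hω
      refine ⟨α + β * (omega : QuadraticAlgebra ℤ (-B) 0), fun _ _ => ⟨?_, fun _ h => ?_⟩⟩
      · convert h1 using 2
        simp [norm_def]; ring
      · have h4 := (intCast_dvd_iff.1 (h3.mul_left ⟨x, y⟩)).2
        rw [mul_sub, im_sub] at h4
        have h5 := (dvd_sub_right h).1 h4
        simp only [im_mul, im_add, im_intCast, re_intCast, re_add, re_mul, omega_re, omega_im] at h5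
        ring_nf at h5
        have h6 := (dvd_add_left (hpy.mul_right _)).1 h5
        exact (hp'.dvd_or_dvd h6).elim hpx h2
    · refine ⟨1, fun hp1 _ => ⟨by simpa using (Nat.prime_iff_prime_int.1 hp1).not_dvd_one, fun h h' => ?_⟩⟩
      exact hp ⟨hp1, h, by simpa using h'⟩
  choose g hg using key
  obtain ⟨v', z', hv', hprim, hzT, hcong⟩ := exists_primitive_norm_eq (a := -B) (b := 0) (A := C) (z := z)
    (n := n) (by omega) (v := ⟨x, y⟩)
    (fun p hp h => (hxy p hp (intCast_dvd_iff.1 h).1 (intCast_dvd_iff.1 h).2))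
    (by rw [norm_def, ← heq]; ring) hz hC (by simpa using hB)
    (fun p hp h h' => by
      have hp' := Nat.prime_iff_prime_int.1 hp
      have h1 : (p : ℤ) ∣ 2 * (2 * B) := by
        rw [show 2 * (2 * B) = -(0 ^ 2 + 4 * -B) by ring]
        exact dvd_neg.2 h'
      exact (hp'.dvd_or_dvd h1).elim (fun h2 => hz2 p hp h2 h) fun h1 =>
        (hp'.dvd_or_dvd h1).elim (fun h2 => hz2 p hp h2 h) (hzB p hp h))
    (T := 2 * M * N * (B * C).natAbs) (by simp [hM, hN, hB, hC]) g (fun p hp _ hpz => (hg p hp hpz).1)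
  have hz'T : ∀ p : ℕ, p.Prime → (p : ℤ) ∣ z' → ¬ (p : ℤ) ∣ 2 * B * C := fun p hp h h' => by
    refine hzT p hp ?_ h
    rw [Int.natCast_dvd] at h'
    refine h'.trans ⟨M * N, ?_⟩
    simp only [Int.natAbs_mul]
    simp; ring
  have heq' : v'.re ^ 2 + B * v'.im ^ 2 = C * z' ^ n := by rw [← hv', norm_def]; ring
  have hprim' : ∀ p : ℕ, p.Prime → (p : ℤ) ∣ v'.re → ¬ (p : ℤ) ∣ v'.im := fun p hp h1 h2 =>
    hprim p hp (intCast_dvd_iff.2 ⟨h1, h2⟩)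
  refine ⟨v'.re, v'.im, z', heq', ?_, fun p hp h => hzT p hp ?_, fun p hp h hy' => ?_⟩
  · rintro p hp ⟨h1, h2⟩
    have hp' := Nat.prime_iff_prime_int.1 hp
    by_cases hpz' : (p : ℤ) ∣ z'
    -- a prime dividing the new `z` does not divide `2 B C`; any other `p` satisfies `p ^ 2 ∣ C`,
    -- and the condition at such `p` is inherited from the old solution
    · have h3 : (p : ℤ) ∣ v'.re := (hp'.dvd_or_dvd h1).resolve_left
        fun h => hz'T p hp hpz' ((h.mul_right _).mul_right _)
      have h4 : (p : ℤ) ∣ B * v'.im ^ 2 := (dvd_add_right (dvd_pow h3 two_ne_zero)).1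
        ((dvd_pow_self _ two_ne_zero).trans h2)
      exact hprim' p hp h3 (hp'.dvd_of_dvd_pow ((hp'.dvd_or_dvd h4).resolve_left
        fun h => hz'T p hp hpz' ((h.mul_left _).mul_right _)))
    · have h3 : (p : ℤ) ^ 2 ∣ C := by
        rw [heq'] at h2
        refine IsCoprime.dvd_of_dvd_mul_right (z := z' ^ n) ?_ h2
        exact IsCoprime.pow (hp'.coprime_iff_not_dvd.2 hpz')
      have h4 : (p : ℤ) ^ 2 ∣ x ^ 2 + B * y ^ 2 := heq ▸ h3.mul_right _
      by_cases hp2 : (p : ℤ) ∣ 2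
      · exact hst p hp ⟨hp2.mul_right _, h4⟩
      · have h5 : (p : ℤ) ∣ v'.re := (hp'.dvd_or_dvd h1).resolve_left hp2
        have h6 : (p : ℤ) ∣ B * v'.im ^ 2 := (dvd_add_right (dvd_pow h5 two_ne_zero)).1
          ((dvd_pow_self _ two_ne_zero).trans h2)
        have h7 : (p : ℤ) ∣ B := (hp'.dvd_or_dvd h6).resolve_right
          fun h => hprim' p hp h5 (hp'.dvd_of_dvd_pow h)
        refine hst p hp ⟨(hp'.dvd_of_dvd_pow (n := 2) ?_).mul_left _, h4⟩
        exact (dvd_add_left (h7.mul_right _)).1 ((dvd_pow_self _ two_ne_zero).trans h4)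
  · exact h.trans ⟨2 * N * (B * C).natAbs, by ring⟩
  · have hpz : ¬ (p : ℤ) ∣ z := by
      by_cases hp2 : p = 2
      · exact hz2 p hp (by simp [hp2])
      · exact hNz p hp h hp2
    have h1 := (intCast_dvd_iff.1 (hcong p hp (h.trans ⟨2 * M * (B * C).natAbs, by ring⟩) hpz)).2
    rw [im_sub] at h1
    exact (hg p hp hpz).2 h ((dvd_sub_right hy').1 h1)

theorem eight_dvd_sq_sub_one {x : ℤ} (hx : ¬ (2 : ℤ) ∣ x) : (8 : ℤ) ∣ x ^ 2 - 1 :=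
  Int.eight_dvd_sq_sub_one_of_odd (Int.not_even_iff_odd.1 fun h => hx h.two_dvd)

/-- If `x` is odd and `x + y √-B` is divisible by `2` among the integers of the field, then `y` is odd
and `B ≡ 3 (mod 4)`. -/
theorem odd_coeff_of_four_dvd {B x y : ℤ} (hx : ¬ (2 : ℤ) ∣ x) (h : (4 : ℤ) ∣ x ^ 2 + B * y ^ 2) :
    ¬ (2 : ℤ) ∣ y ∧ (4 : ℤ) ∣ B + 1 := by
  have h1 := eight_dvd_sq_sub_one hx
  have hy : ¬ (2 : ℤ) ∣ y := by
    rintro ⟨k, rfl⟩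
    have h2 : (4 : ℤ) ∣ B * (2 * k) ^ 2 := ⟨B * k ^ 2, by ring⟩
    omega
  refine ⟨hy, ?_⟩
  have h2 := (eight_dvd_sq_sub_one hy).mul_left B
  rw [mul_sub, mul_one] at h2
  omega

/-- In the situation of the type `*~^0`, the factor `4` can be divided out of the equation, after
moving the power of `2` in `z` to the coefficient if this is necessary. -/
theorem exists_quarter_coeff {n : ℕ} (hn3 : 3 ≤ n) {B C : ℤ} {x y z : ℤ} (hz : z ≠ 0)
    (heq : x ^ 2 + B * y ^ 2 = C * z ^ n) (hx : ¬ (2 : ℤ) ∣ x) (h4 : (4 : ℤ) ∣ x ^ 2 + B * y ^ 2)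
    {M : ℕ} (hM2 : (8 : ℤ) ∣ B + 1 → ¬ (8 : ℤ) ∣ C → Odd M) :
    ∃ w z₁ A : ℤ, z = w * z₁ ∧ 4 * A = C * w ^ n ∧ (¬ (2 : ℤ) ∣ z₁ ∨ (2 : ℤ) ∣ A) ∧
      ∀ p : ℕ, p.Prime → (p : ℤ) ∣ w → p = 2 ∧ ¬ p ∣ M := by
  have h1p : ∀ p : ℕ, p.Prime → ¬ (p : ℤ) ∣ 1 := fun p hp =>
    (Nat.prime_iff_prime_int.1 hp).not_dvd_one
  by_cases hz2 : (2 : ℤ) ∣ z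
  · by_cases hC8 : (8 : ℤ) ∣ C
    · obtain ⟨A, rfl⟩ := hC8
      exact ⟨1, z, 2 * A, by ring, by ring, Or.inr (dvd_mul_right _ _),
        fun p hp h => (h1p p hp h).elim⟩
    · have h8 : ∀ u : ℤ, (2 : ℤ) ∣ u → (8 : ℤ) ∣ u ^ n := fun u h =>
        (show (8 : ℤ) = 2 ^ 3 by norm_num) ▸ (pow_dvd_pow 2 hn3).trans (pow_dvd_pow_of_dvd h n)
      have hB8 : (8 : ℤ) ∣ B + 1 := by
        have h1 : (8 : ℤ) ∣ x ^ 2 + B * y ^ 2 := heq ▸ (h8 z hz2).mul_left _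
        have h2 := dvd_sub h1 (eight_dvd_sq_sub_one hx)
        have h3 := (eight_dvd_sq_sub_one (odd_coeff_of_four_dvd hx h4).1).mul_left B
        have : B + 1 = x ^ 2 + B * y ^ 2 - (x ^ 2 - 1) - B * (y ^ 2 - 1) := by ring
        exact this ▸ dvd_sub h2 h3
      have hM := hM2 hB8 hC8
      obtain ⟨z₁, hz₁, hodd⟩ := (Int.finiteMultiplicity_iff.2
        ⟨by norm_num, hz⟩ : FiniteMultiplicity (2 : ℤ) z).exists_eq_pow_mul_and_not_dvd
      set k := multiplicity 2 z
      have hk : k ≠ 0 := fun h => hodd (by rw [h] at hz₁; simpa [hz₁] using hz2)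
      obtain ⟨q, hq⟩ := h8 (2 ^ k) (dvd_pow_self 2 hk)
      refine ⟨2 ^ k, z₁, C * (2 * q), hz₁, by rw [hq]; ring, Or.inl hodd, fun p hp h => ?_⟩
      have hp2 : p = 2 := (Nat.prime_dvd_prime_iff_eq hp Nat.prime_two).1
        (by exact_mod_cast (Nat.prime_iff_prime_int.1 hp).dvd_of_dvd_pow h)
      exact ⟨hp2, fun h => Nat.not_even_iff_odd.2 hM (even_iff_two_dvd.2 (hp2 ▸ h))⟩
  · obtain ⟨A, rfl⟩ : (4 : ℤ) ∣ C := by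
      refine IsCoprime.dvd_of_dvd_mul_right (z := z ^ n) ?_ (heq ▸ h4)
      have h2 : IsCoprime (2 : ℤ) z := (Int.prime_two.coprime_iff_not_dvd).2 hz2
      exact (show (4 : ℤ) = 2 ^ 2 by norm_num) ▸ h2.pow
    exact ⟨1, z, A, by ring, by ring, Or.inl hz2, fun p hp h => (h1p p hp h).elim⟩

/-- Moving a solution of the type `*~^0`, stated by congruences. The argument is that of
`exists_star_point`, applied to half of `x + y √-B`; that the new `x` and `y` are odd
follows from the congruence modulo `2` if `z₁` is odd, and from the parity of the norm if `A` is
even. -/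
theorem exists_tilde_point {n : ℕ} (hn : Odd n) (hn3 : 3 ≤ n) {B C : ℤ} (hB : B ≠ 0) (hC : C ≠ 0)
    {x y z : ℤ} (hz : z ≠ 0) (heq : x ^ 2 + B * y ^ 2 = C * z ^ n) (hx : ¬ (2 : ℤ) ∣ x)
    (h4 : (4 : ℤ) ∣ x ^ 2 + B * y ^ 2)
    (hst : ∀ p : ℕ, p.Prime → p ≠ 2 → ¬ ((p : ℤ) ∣ 2 * x ∧ (p : ℤ) ^ 2 ∣ x ^ 2 + B * y ^ 2))
    {M N : ℕ} (hM : M ≠ 0) (hN : N ≠ 0) (hM2 : (8 : ℤ) ∣ B + 1 → ¬ (8 : ℤ) ∣ C → Odd M)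
    (hNz : ∀ p : ℕ, p.Prime → p ∣ N → p ≠ 2 → ¬ (p : ℤ) ∣ z)
    (hNn : ∀ p : ℕ, p.Prime → p ∣ N → (p : ℤ) ∣ B → p ∣ n → (p : ℤ) ∣ C) :
    ∃ x' y' z' : ℤ, x' ^ 2 + B * y' ^ 2 = C * z' ^ n ∧ ¬ (2 : ℤ) ∣ x' ∧
      (4 : ℤ) ∣ x' ^ 2 + B * y' ^ 2 ∧
      (∀ p : ℕ, p.Prime → p ≠ 2 → ¬ ((p : ℤ) ∣ 2 * x' ∧ (p : ℤ) ^ 2 ∣ x' ^ 2 + B * y' ^ 2)) ∧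
      (∀ p : ℕ, p.Prime → p ∣ M → ¬ (p : ℤ) ∣ z') ∧ ∀ p : ℕ, p.Prime → p ∣ N → ¬ (p : ℤ) ∣ y' := by
  classical
  obtain ⟨w, z₁, A, rfl, hA, hz₁A, hw⟩ := exists_quarter_coeff hn3 hz heq hx h4 hM2
  obtain ⟨hy2, q, hq⟩ := odd_coeff_of_four_dvd hx h4
  have hw0 : w ≠ 0 := left_ne_zero_of_mul hz
  have hz₁0 : z₁ ≠ 0 := right_ne_zero_of_mul hz
  have hA0 : A ≠ 0 := by
    rintro rfl
    exact mul_ne_zero hC (pow_ne_zero n hw0) (by rw [← hA, mul_zero])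
  have hodd : ∀ {p : ℕ}, p.Prime → p ≠ 2 → ¬ (p : ℤ) ∣ 2 := fun {p} hp h h' =>
    h ((Nat.prime_dvd_prime_iff_eq hp Nat.prime_two).1 (by exact_mod_cast h'))
  have hxy : ∀ p : ℕ, p.Prime → (p : ℤ) ∣ x → (p : ℤ) ∣ y → False := fun p hp h1 h2 =>
    hst p hp (by rintro rfl; exact hx h1) ⟨h1.mul_left _,
      dvd_add (pow_dvd_pow_of_dvd h1 2) ((pow_dvd_pow_of_dvd h2 2).mul_left _)⟩
  have hzB : ∀ p : ℕ, p.Prime → (p : ℤ) ∣ z₁ → ¬ (p : ℤ) ∣ B := fun p hp h hpB => by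
    have hp2 : p ≠ 2 := by rintro rfl; norm_num at hpB; omega
    have h0 : (p : ℤ) ∣ w * z₁ := h.mul_left _
    have h1 : (p : ℤ) ∣ x ^ 2 :=
      (dvd_add_left (hpB.mul_right _)).1 (heq ▸ (dvd_pow h0 (by omega)).mul_left C)
    exact hst p hp hp2 ⟨((Nat.prime_iff_prime_int.1 hp).dvd_of_dvd_pow h1).mul_left _,
      heq ▸ ((pow_dvd_pow_of_dvd h0 2).trans (pow_dvd_pow _ (by omega))).mul_left _⟩
  -- the element `v = (x + y √-B) / 2` of the order `ℤ[(1 + √-B) / 2]`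
  obtain ⟨X, rfl⟩ : ∃ X, x = 2 * X + y := ⟨(x - y) / 2, by omega⟩
  -- `r` is the square root of `-B` in this order
  set r : QuadraticAlgebra ℤ (-q) 1 := ⟨-1, 2⟩ with hr
  have hr2 : r ^ 2 = -((B : ℤ) : QuadraticAlgebra ℤ (-q) 1) := by
    ext
    · simp [pow_two, hr]; linarith
    · simp [pow_two, hr]
  -- the local factors: trivial at `2`, and such that `y` becomes prime to `p` for `p ∣ N`
  have key : ∀ p : ℕ, ∃ g : QuadraticAlgebra ℤ (-q) 1, p.Prime → ¬ (p : ℤ) ∣ z₁ →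
      ¬ (p : ℤ) ∣ norm g ∧ (p = 2 → g = 1) ∧
        (p ∣ N → ¬ (p : ℤ) ∣ ((⟨X, y⟩ : QuadraticAlgebra ℤ (-q) 1) * g ^ n).im) := by
    intro p
    by_cases hp : p.Prime ∧ p ∣ N ∧ (p : ℤ) ∣ y
    · obtain ⟨hp, hpN, hpy⟩ := hp
      have hp' := Nat.prime_iff_prime_int.1 hp
      have hp2 : p ≠ 2 := by rintro rfl; exact hy2 hpy
      have hpx : ¬ (p : ℤ) ∣ 2 * X + y := fun h => hxy p hp h hpy
      have hBn : (p : ℤ) ∣ B → ¬ p ∣ n := fun h1 h2 => hpx <| hp'.dvd_of_dvd_pow (n := 2) <|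
        (dvd_add_left (h1.mul_right _)).1 (heq ▸ (hNn p hp hpN h1 h2).mul_right _)
      obtain ⟨α, β, P, Q, h1, h2, h3⟩ := exists_pow_irrational hn hp hBn hr2
      refine ⟨α + β * r, fun _ _ => ⟨?_, fun h => (hp2 h).elim, fun _ h => ?_⟩⟩
      · convert h1 using 2
        simp [norm_def, hr]
        linear_combination -β ^ 2 * hq
      · have h4 := (intCast_dvd_iff.1 (h3.mul_left ⟨X, y⟩)).2
        rw [mul_sub, im_sub] at h4
        have h5 := (dvd_sub_right h).1 h4
        simp only [hr, im_mul, im_add, im_intCast, re_intCast, re_add, re_mul, Int.cast_id] at h5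
        have h6 : (p : ℤ) ∣ (2 * X + y) * Q := by
          refine (dvd_add_left (hpy.mul_right P)).1 ?_
          convert h5 using 1
          ring
        exact (hp'.dvd_or_dvd h6).elim hpx h2
    · refine ⟨1, fun hp1 _ => ⟨by simpa using (Nat.prime_iff_prime_int.1 hp1).not_dvd_one,
        fun _ => rfl, fun h h' => ?_⟩⟩
      exact hp ⟨hp1, h, by simpa using h'⟩
  choose g hg using key
  have hNv : norm (⟨X, y⟩ : QuadraticAlgebra ℤ (-q) 1) = A * z₁ ^ n := by
    rw [norm_def]
    refine mul_left_cancel₀ (four_ne_zero) ?_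
    linear_combination heq - y ^ 2 * hq - z₁ ^ n * hA
  obtain ⟨v', z', hv', hprim, hzT, hcong⟩ := exists_primitive_norm_eq (n := n) (by omega)
    (fun p hp h => by
      obtain ⟨h1, h2⟩ := intCast_dvd_iff.1 h
      exact hxy p hp (dvd_add (h1.mul_left 2) h2) h2)
    hNv hz₁0 hA0 (by intro h; apply hB; linarith)
    (fun p hp h h' => hzB p hp h (by
      rw [show B = -(1 ^ 2 + 4 * -q) by linarith]
      exact dvd_neg.2 h'))
    (T := 2 * M * N * (B * C).natAbs) (by simp [hM, hN, hB, hC]) g (fun p hp _ hpz => (hg p hp hpz).1)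
  have hz'2 : ¬ (2 : ℤ) ∣ z' := hzT 2 Nat.prime_two ⟨M * N * (B * C).natAbs, by ring⟩
  have hz'T : ∀ p : ℕ, p.Prime → (p : ℤ) ∣ z' → ¬ (p : ℤ) ∣ B * C := fun p hp h h' => by
    exact hzT p hp ((Int.natCast_dvd.1 h').mul_left _) h
  have heq₁ : (2 * v'.re + v'.im) ^ 2 + B * v'.im ^ 2 = 4 * (A * z' ^ n) := by
    rw [← hv', norm_def]
    linear_combination v'.im ^ 2 * hq
  have heq' : (2 * v'.re + v'.im) ^ 2 + B * v'.im ^ 2 = C * (w * z') ^ n := by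
    rw [heq₁]
    linear_combination z' ^ n * hA
  have hy'2 : ¬ (2 : ℤ) ∣ v'.im := by
    intro hy'
    rcases hz₁A with h | h
    · have h1 := (intCast_dvd_iff.1 (hcong 2 Nat.prime_two ⟨M * N * (B * C).natAbs, by ring⟩ h)).2
      rw [(hg 2 Nat.prime_two h).2.1 rfl, one_pow, mul_one, im_sub] at h1
      exact hy2 ((dvd_sub_right hy').1 h1)
    · refine hprim 2 Nat.prime_two (intCast_dvd_iff.2 ⟨?_, hy'⟩)
      refine Int.prime_two.dvd_of_dvd_pow (n := 2) ?_
      have : v'.re ^ 2 = A * z' ^ n - v'.im * (v'.re + q * v'.im) := by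
        rw [← hv', norm_def]; ring
      exact this ▸ dvd_sub (h.mul_right _) (hy'.mul_right _)
  have hprim' : ∀ p : ℕ, p.Prime → p ≠ 2 → (p : ℤ) ∣ 2 * v'.re + v'.im → ¬ (p : ℤ) ∣ v'.im :=
    fun p hp hp2 h1 h2 => hprim p hp (intCast_dvd_iff.2
      ⟨((Nat.prime_iff_prime_int.1 hp).dvd_or_dvd ((dvd_add_left h2).1 h1)).resolve_left
        (hodd hp hp2), h2⟩)
  refine ⟨2 * v'.re + v'.im, v'.im, w * z', heq', by omega, heq₁ ▸ dvd_mul_right _ _, ?_,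
    fun p hp h h' => ?_, fun p hp h hy' => ?_⟩
  · rintro p hp hp2 ⟨h1, h2⟩
    have hp' := Nat.prime_iff_prime_int.1 hp
    have h3 : (p : ℤ) ∣ 2 * v'.re + v'.im := (hp'.dvd_or_dvd h1).resolve_left (hodd hp hp2)
    have h4 : (p : ℤ) ∣ B * v'.im ^ 2 := (dvd_add_right (dvd_pow h3 two_ne_zero)).1
      ((dvd_pow_self _ two_ne_zero).trans h2)
    have h5 : (p : ℤ) ∣ B := (hp'.dvd_or_dvd h4).resolve_right
      fun h => hprim' p hp hp2 h3 (hp'.dvd_of_dvd_pow h)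
    have h6 : ¬ (p : ℤ) ∣ w * z' := fun h => (hp'.dvd_or_dvd h).elim
      (fun h => hp2 (hw p hp h).1) (fun h => hz'T p hp h (h5.mul_right _))
    have h7 : (p : ℤ) ^ 2 ∣ C := by
      rw [heq'] at h2
      exact IsCoprime.dvd_of_dvd_mul_right (IsCoprime.pow (hp'.coprime_iff_not_dvd.2 h6)) h2
    have h8 : (p : ℤ) ^ 2 ∣ (2 * X + y) ^ 2 + B * y ^ 2 := heq ▸ h7.mul_right _
    refine hst p hp hp2 ⟨(hp'.dvd_of_dvd_pow (n := 2) ?_).mul_left _, h8⟩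
    exact (dvd_add_left (h5.mul_right _)).1 ((dvd_pow_self _ two_ne_zero).trans h8)
  · refine ((Nat.prime_iff_prime_int.1 hp).dvd_or_dvd h').elim (fun h' => (hw p hp h').2 h) ?_
    exact hzT p hp (h.trans ⟨2 * N * (B * C).natAbs, by ring⟩)
  · by_cases hp2 : p = 2
    · exact hy'2 (by simpa [hp2] using hy')
    · have hpz : ¬ (p : ℤ) ∣ z₁ := fun h' => hNz p hp h hp2 (h'.mul_left _)
      have h1 := (intCast_dvd_iff.1 (hcong p hp (h.trans ⟨2 * M * (B * C).natAbs, by ring⟩) hpz)).2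
      rw [im_sub] at h1
      exact (hg p hp hpz).2.2 h ((dvd_sub_right hy').1 h1)

end

/-! ### The square part of an integer -/

theorem sqPart_pos {B : ℤ} (hB : B ≠ 0) : 0 < sqPart B := by
  refine Nat.pos_of_ne_zero fun h => hB ?_
  have := sqPart_sq_mul_sqfPart B
  rw [h] at this
  simpa using this.symm

theorem sqfPart_ne_zero {B : ℤ} (hB : B ≠ 0) : sqfPart B ≠ 0 := fun h =>
  hB (by rw [← sqPart_sq_mul_sqfPart B, h, mul_zero])

theorem not_sq_dvd_sqfPart {B : ℤ} (hB : B ≠ 0) {p : ℕ} (hp : p.Prime) :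
    ¬ (p : ℤ) ^ 2 ∣ sqfPart B := by
  intro h
  have h1 : ((sqPart B * p) ^ 2 : ℕ) ∣ B.natAbs := by
    rw [← Int.natCast_dvd]
    conv_rhs => rw [← sqPart_sq_mul_sqfPart B]
    push_cast
    rw [mul_pow]
    exact mul_dvd_mul_left _ h
  have h2 : sqPart B * p ≤ B.natAbs :=
    (Nat.le_self_pow two_ne_zero _).trans (Nat.le_of_dvd (by simpa using hB) h1)
  have h3 : sqPart B * p ≤ sqPart B := Nat.le_findGreatest h2 h1
  have := hp.two_le
  have := sqPart_pos hB
  nlinarith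

theorem padicValInt_eq_sqPart {B : ℤ} (hB : B ≠ 0) {p : ℕ} (hp : p.Prime) :
    padicValInt p B = 2 * padicValNat p (sqPart B) + padicValInt p (sqfPart B) := by
  have := Fact.mk hp
  conv_lhs => rw [← sqPart_sq_mul_sqfPart B]
  rw [padicValInt.mul (pow_ne_zero 2 (by exact_mod_cast (sqPart_pos hB).ne')) (sqfPart_ne_zero hB),
    pow_two, padicValInt.mul (by exact_mod_cast (sqPart_pos hB).ne')
      (by exact_mod_cast (sqPart_pos hB).ne'), padicValInt.of_nat]
  ring

theorem pow_dvd_iff_le_padicValInt {p : ℕ} (hp : p.Prime) {a : ℤ} (ha : a ≠ 0) {k : ℕ} :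
    (p : ℤ) ^ k ∣ a ↔ k ≤ padicValInt p a := by
  have := Fact.mk hp
  rw [padicValInt_dvd_iff]
  simp [ha]

theorem padicValInt_sqfPart_le {B : ℤ} (hB : B ≠ 0) {p : ℕ} (hp : p.Prime) :
    padicValInt p (sqfPart B) ≤ 1 := by
  by_contra! h
  exact not_sq_dvd_sqfPart hB hp ((pow_dvd_iff_le_padicValInt hp (sqfPart_ne_zero hB)).2 h)

theorem padicValNat_sqPart {B : ℤ} (hB : B ≠ 0) {p : ℕ} (hp : p.Prime) :
    padicValNat p (sqPart B) = padicValInt p B / 2 := by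
  have := padicValInt_eq_sqPart hB hp
  have := padicValInt_sqfPart_le hB hp
  omega

theorem dvd_of_forall_padicValNat_le {a b : ℕ} (ha : a ≠ 0) (hb : b ≠ 0)
    (h : ∀ p : ℕ, p.Prime → padicValNat p a ≤ padicValNat p b) : a ∣ b := by
  rw [← Nat.factorization_le_iff_dvd ha hb]
  intro p
  by_cases hp : p.Prime
  · simpa [Nat.factorization_def _ hp] using h p hp
  · simp [Nat.factorization_eq_zero_of_not_prime _ hp]

theorem sq_dvd_iff_dvd_sqPart {B : ℤ} (hB : B ≠ 0) {d : ℕ} :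
    (d : ℤ) ^ 2 ∣ B ↔ d ∣ sqPart B := by
  constructor
  · intro h
    have hd : d ≠ 0 := by rintro rfl; exact hB (by simpa using h)
    refine dvd_of_forall_padicValNat_le hd (sqPart_pos hB).ne' fun p hp => ?_
    rw [padicValNat_sqPart hB hp]
    have := Fact.mk hp
    have h1 : (p : ℤ) ^ (2 * padicValNat p d) ∣ B := by
      refine dvd_trans ?_ h
      rw [mul_comm, pow_mul]
      exact pow_dvd_pow_of_dvd (by exact_mod_cast pow_padicValNat_dvd) 2
    rw [pow_dvd_iff_le_padicValInt hp hB] at h1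
    omega
  · exact fun h => (pow_dvd_pow_of_dvd (by exact_mod_cast h) 2).trans (sqPart_sq_dvd B)

theorem sqPart_sq_mul {B : ℤ} (hB : B ≠ 0) {g : ℕ} (hg : g ≠ 0) :
    sqPart ((g : ℤ) ^ 2 * B) = g * sqPart B := by
  have hgB : (g : ℤ) ^ 2 * B ≠ 0 := mul_ne_zero (pow_ne_zero 2 (by exact_mod_cast hg)) hB
  refine Nat.eq_of_factorization_eq (sqPart_pos hgB).ne' (mul_ne_zero hg (sqPart_pos hB).ne')
    fun p => ?_
  by_cases hp : p.Prime
  · have := Fact.mk hp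
    rw [Nat.factorization_def _ hp, Nat.factorization_def _ hp, padicValNat_sqPart hgB hp,
      padicValNat.mul hg (sqPart_pos hB).ne', padicValNat_sqPart hB hp,
      padicValInt.mul (pow_ne_zero 2 (by exact_mod_cast hg)) hB, pow_two,
      padicValInt.mul (by exact_mod_cast hg) (by exact_mod_cast hg), padicValInt.of_nat]
    omega
  · simp [Nat.factorization_eq_zero_of_not_prime _ hp]

theorem sqfPart_sq_mul {B : ℤ} (hB : B ≠ 0) {g : ℕ} (hg : g ≠ 0) :
    sqfPart ((g : ℤ) ^ 2 * B) = sqfPart B := by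
  have h1 := sqPart_sq_mul_sqfPart ((g : ℤ) ^ 2 * B)
  rw [sqPart_sq_mul hB hg] at h1
  have h2 : ((g * sqPart B : ℕ) : ℤ) ^ 2 ≠ 0 :=
    pow_ne_zero 2 (by exact_mod_cast mul_ne_zero hg (sqPart_pos hB).ne')
  refine mul_left_cancel₀ h2 (h1.trans ?_)
  conv_lhs => rw [← sqPart_sq_mul_sqfPart B]
  push_cast; ring

/-! ### Removing the common square factor of the coefficients -/

section Reduction

variable {B C : ℤ}

theorem commonSq_ne_zero (hB : B ≠ 0) : commonSq B C ≠ 0 :=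
  (sqPart_pos (by simp [Int.gcd_eq_zero_iff, hB])).ne'

theorem commonSq_sq_mul_redB : (commonSq B C : ℤ) ^ 2 * redB B C = B :=
  Int.mul_ediv_cancel' ((sqPart_sq_dvd _).trans (Int.gcd_dvd_left ..))

theorem commonSq_sq_mul_redC : (commonSq B C : ℤ) ^ 2 * redC B C = C :=
  Int.mul_ediv_cancel' ((sqPart_sq_dvd _).trans (Int.gcd_dvd_right ..))

theorem redB_ne_zero (hB : B ≠ 0) : redB B C ≠ 0 := fun h =>
  hB (by rw [← commonSq_sq_mul_redB (B := B) (C := C), h, mul_zero])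

theorem redC_ne_zero (hC : C ≠ 0) : redC B C ≠ 0 := fun h =>
  hC (by rw [← commonSq_sq_mul_redC (B := B) (C := C), h, mul_zero])

theorem sqPart_eq_commonSq_mul (hB : B ≠ 0) :
    sqPart B = commonSq B C * sqPart (redB B C) := by
  rw [← sqPart_sq_mul (redB_ne_zero hB) (commonSq_ne_zero hB), commonSq_sq_mul_redB]

theorem sqfPart_redB (hB : B ≠ 0) : sqfPart (redB B C) = sqfPart B := by
  rw [← sqfPart_sq_mul (redB_ne_zero (C := C) hB) (commonSq_ne_zero (C := C) hB),
    commonSq_sq_mul_redB]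

theorem not_sq_dvd_redB_redC (hB : B ≠ 0) {p : ℕ} (hp : p.Prime) :
    ¬ ((p : ℤ) ^ 2 ∣ redB B C ∧ (p : ℤ) ^ 2 ∣ redC B C) := by
  rintro ⟨h1, h2⟩
  have h3 : ((commonSq B C * p : ℕ) : ℤ) ^ 2 ∣ (Int.gcd B C : ℤ) := by
    push_cast
    rw [mul_pow]
    refine Int.dvd_coe_gcd ?_ ?_
    · conv_rhs => rw [← commonSq_sq_mul_redB (B := B) (C := C)]
      exact mul_dvd_mul_left _ h1
    · conv_rhs => rw [← commonSq_sq_mul_redC (B := B) (C := C)]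
      exact mul_dvd_mul_left _ h2
  rw [sq_dvd_iff_dvd_sqPart (by simp [Int.gcd_eq_zero_iff, hB])] at h3
  have h4 : commonSq B C * p ∣ commonSq B C * 1 := by rw [mul_one]; exact h3
  exact hp.one_lt.ne' (Nat.dvd_one.1 (Nat.dvd_of_mul_dvd_mul_left
    (Nat.pos_of_ne_zero (commonSq_ne_zero hB)) h4))

theorem not_isSquare_neg_redB (h : ¬ IsSquare (-B)) : ¬ IsSquare (-redB B C) := by
  rintro ⟨k, hk⟩
  refine h ⟨commonSq B C * k, ?_⟩
  linear_combination (commonSq B C : ℤ) ^ 2 * hk + commonSq_sq_mul_redB (B := B) (C := C)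

theorem points_sq_mul_nonempty_iff {n : ℕ} (hn : n ≠ 0) {g : ℤ} (hg : g ≠ 0) :
    (Points n (g ^ 2 * B) (g ^ 2 * C)).Nonempty ↔ (Points n B C).Nonempty := by
  constructor
  · rintro ⟨⟨x, y, z⟩, hgcd, heq⟩
    simp only at hgcd heq
    obtain ⟨x, rfl⟩ : g ∣ x := (Int.pow_dvd_pow_iff two_ne_zero).1
      ⟨C * z ^ n - B * y ^ 2, by linear_combination heq⟩
    refine ⟨(x, y, z), ?_, mul_left_cancel₀ (pow_ne_zero 2 hg) (by linear_combination heq)⟩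
    simp only
    rw [Int.gcd_assoc, gcd_eq_one_iff_forall_prime] at hgcd ⊢
    exact fun p hp h => hgcd p hp ⟨h.1.mul_left _, h.2⟩
  · rintro ⟨⟨x, y, z⟩, hgcd, heq⟩
    simp only at hgcd heq
    refine ⟨(g * x, y, z), ?_, by simp only; linear_combination g ^ 2 * heq⟩
    simp only
    rw [Int.gcd_assoc, gcd_eq_one_iff_forall_prime] at hgcd ⊢
    rintro p hp ⟨-, h4⟩
    refine hgcd p hp ⟨(Nat.prime_iff_prime_int.1 hp).dvd_of_dvd_pow (n := 2) ?_, h4⟩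
    rw [Int.dvd_coe_gcd_iff] at h4
    rw [eq_sub_of_add_eq heq]
    exact dvd_sub ((dvd_pow h4.2 hn).mul_left _) ((dvd_pow h4.1 two_ne_zero).mul_left _)

theorem points_redB_redC_nonempty_iff {n : ℕ} (hn : n ≠ 0) (hB : B ≠ 0) :
    (Points n (redB B C) (redC B C)).Nonempty ↔ (Points n B C).Nonempty := by
  rw [← points_sq_mul_nonempty_iff hn (g := commonSq B C) (by exact_mod_cast commonSq_ne_zero hB),
    commonSq_sq_mul_redB, commonSq_sq_mul_redC]

end Reduction

/-! ### The coefficients attached to a cascade datum -/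

theorem padicValNat_prod_pow (S : Finset ℕ) (hS : ∀ p ∈ S, p.Prime) (k : ℕ → ℕ) {q : ℕ}
    (hq : q.Prime) : padicValNat q (∏ p ∈ S, p ^ k p) = if q ∈ S then k q else 0 := by
  have := Fact.mk hq
  induction S using Finset.induction_on with
  | empty => simp
  | insert p S hp ih =>
    have hp' := hS p (Finset.mem_insert_self _ _)
    have hS' : ∀ p ∈ S, p.Prime := fun p hp => hS p (Finset.mem_insert_of_mem hp)
    rw [Finset.prod_insert hp, padicValNat.mul (pow_ne_zero _ hp'.ne_zero)
      (Finset.prod_ne_zero_iff.2 fun r hr => pow_ne_zero _ (hS' r hr).ne_zero), ih hS',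
      padicValNat.pow]
    by_cases hqp : q = p
    · subst hqp; simp [hp]
    · have := Fact.mk hp'
      simp [padicValNat_primes hqp, hqp]

section

variable {n : ℕ} {B C : ℤ} {d : ℕ}

theorem mem_primesOfF {p : ℕ} : p ∈ primesOfF B d ↔ (p.Prime ∧ p ∣ d ∧ d ≠ 0) ∧ p ∣ sqPart B := by
  rw [primesOfF, Finset.mem_filter, Nat.mem_primeFactors]

theorem mem_primesOffF {p : ℕ} :
    p ∈ primesOffF B d ↔ (p.Prime ∧ p ∣ d ∧ d ≠ 0) ∧ ¬ p ∣ sqPart B := by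
  rw [primesOffF, Finset.mem_filter, Nat.mem_primeFactors]

theorem dvd_prod_id_iff {S : Finset ℕ} (hS : ∀ p ∈ S, p.Prime) {q : ℕ} (hq : q.Prime) :
    q ∣ ∏ p ∈ S, p ↔ q ∈ S := by
  refine ⟨fun h => ?_, fun h => Finset.dvd_prod_of_mem _ h⟩
  obtain ⟨p, hp, hqp⟩ := (hq.prime.dvd_finsetProd_iff _).1 h
  rwa [(Nat.prime_dvd_prime_iff_eq hq (hS p hp)).1 hqp]

theorem dvd_yMod_iff (hd : d ≠ 0) {p : ℕ} (hp : p.Prime) :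
    p ∣ yMod B d ↔ p ∣ d ∧ p ∣ sqPart B := by
  rw [yMod, dvd_prod_id_iff (fun q hq => (mem_primesOfF.1 hq).1.1) hp, mem_primesOfF]
  tauto

theorem dvd_zMod_iff (hd : d ≠ 0) {p : ℕ} (hp : p.Prime) :
    p ∣ zMod B d ↔ p ∣ d ∧ ¬ p ∣ sqPart B := by
  rw [zMod, dvd_prod_id_iff (fun q hq => (mem_primesOffF.1 hq).1.1) hp, mem_primesOffF]
  tauto

theorem yMod_ne_zero : yMod B d ≠ 0 :=
  Finset.prod_ne_zero_iff.2 fun _ hp => (mem_primesOfF.1 hp).1.1.ne_zero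

theorem zMod_ne_zero : zMod B d ≠ 0 :=
  Finset.prod_ne_zero_iff.2 fun _ hp => (mem_primesOffF.1 hp).1.1.ne_zero

theorem zFactor_ne_zero : zFactor n B C d ≠ 0 :=
  Finset.prod_ne_zero_iff.2 fun _ hp => pow_ne_zero _ (mem_primesOfF.1 hp).1.1.ne_zero

theorem fFactor_ne_zero : fFactor B d ≠ 0 :=
  Finset.prod_ne_zero_iff.2 fun _ hp => pow_ne_zero _ (mem_primesOfF.1 hp).1.1.ne_zero

/-- The part of `d` prime to the square part of `B`. -/
def offFactor (B : ℤ) (d : ℕ) : ℕ :=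
  ∏ p ∈ primesOffF B d, p ^ padicValNat p d

theorem fFactor_mul_offFactor (hd : d ≠ 0) : fFactor B d * offFactor B d = d := by
  rw [fFactor, offFactor, primesOfF, primesOffF, Finset.prod_filter_mul_prod_filter_not]
  conv_rhs => rw [← Nat.prod_factorization_pow_eq_self hd]
  rw [Nat.prod_factorization_eq_prod_primeFactors]
  exact Finset.prod_congr rfl fun p hp => by
    rw [Nat.factorization_def _ (Nat.prime_of_mem_primeFactors hp)]

theorem dvd_offFactor_iff (hd : d ≠ 0) {p : ℕ} (hp : p.Prime) :
    p ∣ offFactor B d ↔ p ∣ d ∧ ¬ p ∣ sqPart B := by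
  constructor
  · intro h
    obtain ⟨q, hq, hpq⟩ := (hp.prime.dvd_finsetProd_iff _).1 h
    have hq' := mem_primesOffF.1 hq
    rw [(Nat.prime_dvd_prime_iff_eq hp hq'.1.1).1 (hp.dvd_of_dvd_pow hpq)]
    exact ⟨hq'.1.2.1, hq'.2⟩
  · rintro ⟨h1, h2⟩
    have := Fact.mk hp
    exact (dvd_pow_self p (one_le_padicValNat_of_dvd hd h1 |> Nat.one_le_iff_ne_zero.1)).trans
      (Finset.dvd_prod_of_mem (fun p => p ^ padicValNat p d) (mem_primesOffF.2 ⟨⟨hp, h1, hd⟩, h2⟩))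

theorem padicValNat_fFactor (hd : d ≠ 0) {p : ℕ} (hp : p.Prime) :
    padicValNat p (fFactor B d) = if p ∣ sqPart B then padicValNat p d else 0 := by
  rw [fFactor, padicValNat_prod_pow _ (fun q hq => (mem_primesOfF.1 hq).1.1) _ hp]
  by_cases hpd : p ∣ d
  · simp [mem_primesOfF, hp, hd, hpd]
  · simp [padicValNat.eq_zero_of_not_dvd hpd]

theorem padicValNat_zFactor (hd : d ≠ 0) {p : ℕ} (hp : p.Prime) :
    padicValNat p (zFactor n B C d) =
      if p ∣ sqPart B then (2 * padicValNat p d - padicValInt p C) ⌈/⌉ n else 0 := by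
  rw [zFactor, padicValNat_prod_pow _ (fun q hq => (mem_primesOfF.1 hq).1.1) _ hp]
  by_cases hpd : p ∣ d
  · simp [mem_primesOfF, hp, hd, hpd]
  · simp [padicValNat.eq_zero_of_not_dvd hpd, mem_primesOfF, hpd]

theorem padicValNat_sqPart_pos_iff (hB : B ≠ 0) {p : ℕ} (hp : p.Prime) :
    0 < padicValNat p (sqPart B) ↔ p ∣ sqPart B := by
  have := Fact.mk hp
  rw [Nat.pos_iff_ne_zero, ← dvd_iff_padicValNat_ne_zero (sqPart_pos hB).ne']

theorem sq_dvd_of_dvd_sqPart {p : ℕ} (h : p ∣ sqPart B) : (p : ℤ) ^ 2 ∣ B :=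
  (pow_dvd_pow_of_dvd (by exact_mod_cast h) 2).trans (sqPart_sq_dvd B)

/-- If `gcd(B, C)` is squarefree, then `v_p(C) ≤ 1` at the primes `p ∣ f`. -/
theorem padicValInt_le_one (hC : C ≠ 0)
    (hred : ∀ p : ℕ, p.Prime → ¬ ((p : ℤ) ^ 2 ∣ B ∧ (p : ℤ) ^ 2 ∣ C)) {p : ℕ} (hp : p.Prime)
    (h : p ∣ sqPart B) : padicValInt p C ≤ 1 := by
  by_contra! hc
  exact hred p hp ⟨sq_dvd_of_dvd_sqPart h, (pow_dvd_iff_le_padicValInt hp hC).2 hc⟩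

/-- The local condition on the exponents, in terms of divisibility by `p`. -/
theorem localExp_cases (hB : B ≠ 0) {p s : ℕ} (hp : p.Prime) (h : LocalExp n B C p s) :
    (¬ p ∣ sqPart B ∧ 2 * s ≤ padicValInt p C) ∨
    (p ∣ sqPart B ∧ s = 0 ∧ padicValInt p C = 0) ∨
    (p ∣ sqPart B ∧ 0 < s ∧ s ≤ padicValNat p (sqPart B) ∧
      (s = padicValNat p (sqPart B) ∨ n ∣ 2 * s - padicValInt p C)) := by
  have h1 := padicValNat_sqPart_pos_iff hB hp
  rcases h with ⟨h, h'⟩ | ⟨h, h' | h'⟩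
  · exact Or.inl ⟨fun h2 => (h1.2 h2).ne' h, h'⟩
  · exact Or.inr (Or.inl ⟨h1.1 h, h'⟩)
  · exact Or.inr (Or.inr ⟨h1.1 h, h'⟩)

theorem fFactor_dvd_sqPart (hB : B ≠ 0) (hd : d ≠ 0)
    (hL : ∀ p : ℕ, p.Prime → LocalExp n B C p (padicValNat p d)) : fFactor B d ∣ sqPart B := by
  refine dvd_of_forall_padicValNat_le fFactor_ne_zero (sqPart_pos hB).ne' fun p hp => ?_
  rw [padicValNat_fFactor hd hp]
  rcases localExp_cases hB hp (hL p hp) with h | h | h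
  · simp [h.1]
  · simp [h.2.1]
  · rw [if_pos h.1]; exact h.2.2.1

theorem fFactor_sq_mul_newB (hB : B ≠ 0) (hd : d ≠ 0)
    (hL : ∀ p : ℕ, p.Prime → LocalExp n B C p (padicValNat p d)) :
    (fFactor B d : ℤ) ^ 2 * newB B d = B :=
  Int.mul_ediv_cancel' (sq_dvd_of_dvd_sqPart (fFactor_dvd_sqPart hB hd hL))

theorem newB_ne_zero (hB : B ≠ 0) (hd : d ≠ 0)
    (hL : ∀ p : ℕ, p.Prime → LocalExp n B C p (padicValNat p d)) : newB B d ≠ 0 := fun h =>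
  hB (by rw [← fFactor_sq_mul_newB hB hd hL, h, mul_zero])

theorem sqPart_eq_fFactor_mul (hB : B ≠ 0) (hd : d ≠ 0)
    (hL : ∀ p : ℕ, p.Prime → LocalExp n B C p (padicValNat p d)) :
    sqPart B = fFactor B d * sqPart (newB B d) := by
  rw [← sqPart_sq_mul (newB_ne_zero hB hd hL) fFactor_ne_zero, fFactor_sq_mul_newB hB hd hL]

theorem sqfPart_newB (hB : B ≠ 0) (hd : d ≠ 0)
    (hL : ∀ p : ℕ, p.Prime → LocalExp n B C p (padicValNat p d)) :
    sqfPart (newB B d) = sqfPart B := by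
  rw [← sqfPart_sq_mul (newB_ne_zero hB hd hL) (fFactor_ne_zero (B := B) (d := d)),
    fFactor_sq_mul_newB hB hd hL]

theorem padicValInt_mul_zFactor_pow (hC : C ≠ 0) {p : ℕ} (hp : p.Prime) :
    padicValInt p (C * (zFactor n B C d : ℤ) ^ n)
      = padicValInt p C + n * padicValNat p (zFactor n B C d) := by
  have := Fact.mk hp
  have hz : (zFactor n B C d : ℤ) ≠ 0 := by exact_mod_cast zFactor_ne_zero
  rw [padicValInt.mul hC (pow_ne_zero _ hz), ← Nat.cast_pow, padicValInt.of_nat,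
    padicValNat.pow]

theorem sq_mul_newC (hn : 0 < n) (hB : B ≠ 0) (hC : C ≠ 0) (hd : d ≠ 0)
    (hL : ∀ p : ℕ, p.Prime → LocalExp n B C p (padicValNat p d)) :
    (d : ℤ) ^ 2 * newC n B C d = C * (zFactor n B C d : ℤ) ^ n := by
  refine Int.mul_ediv_cancel' ?_
  have h0 : C * (zFactor n B C d : ℤ) ^ n ≠ 0 :=
    mul_ne_zero hC (pow_ne_zero _ (by exact_mod_cast zFactor_ne_zero))
  rw [sq_dvd_iff_dvd_sqPart h0]
  refine dvd_of_forall_padicValNat_le hd (sqPart_pos h0).ne' fun p hp => ?_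
  rw [padicValNat_sqPart h0 hp, padicValInt_mul_zFactor_pow hC hp, padicValNat_zFactor hd hp,
    Nat.le_div_iff_mul_le two_pos]
  have hle : 2 * padicValNat p d - padicValInt p C
      ≤ n * ((2 * padicValNat p d - padicValInt p C) ⌈/⌉ n) := (ceilDiv_le_iff_le_mul hn).1 le_rfl
  rcases localExp_cases hB hp (hL p hp) with h | h | h
  · rw [if_neg h.1]; omega
  · simp [h.2.1]
  · rw [if_pos h.1]; omega

theorem newC_ne_zero (hn : 0 < n) (hB : B ≠ 0) (hC : C ≠ 0) (hd : d ≠ 0)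
    (hL : ∀ p : ℕ, p.Prime → LocalExp n B C p (padicValNat p d)) : newC n B C d ≠ 0 := fun h => by
  have h1 := sq_mul_newC hn hB hC hd hL
  rw [h, mul_zero] at h1
  exact mul_ne_zero hC (pow_ne_zero _ (by exact_mod_cast zFactor_ne_zero)) h1.symm

theorem padicValInt_newC (hn : 0 < n) (hB : B ≠ 0) (hC : C ≠ 0) (hd : d ≠ 0)
    (hL : ∀ p : ℕ, p.Prime → LocalExp n B C p (padicValNat p d)) {p : ℕ} (hp : p.Prime) :
    2 * padicValNat p d + padicValInt p (newC n B C d)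
      = padicValInt p C + n * padicValNat p (zFactor n B C d) := by
  have := Fact.mk hp
  have hd' : (d : ℤ) ≠ 0 := by exact_mod_cast hd
  rw [← padicValInt_mul_zFactor_pow hC hp, ← sq_mul_newC hn hB hC hd hL,
    padicValInt.mul (pow_ne_zero 2 hd') (newC_ne_zero hn hB hC hd hL), pow_two,
    padicValInt.mul hd' hd', padicValInt.of_nat]
  ring

/-- At a prime `p ∣ f` with `n ∣ 2 s - v_p(C)`, the new coefficient is prime to `p`. -/
theorem padicValInt_newC_eq_zero (hn : 0 < n) (hB : B ≠ 0) (hC : C ≠ 0)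
    (hred : ∀ p : ℕ, p.Prime → ¬ ((p : ℤ) ^ 2 ∣ B ∧ (p : ℤ) ^ 2 ∣ C)) (hd : d ≠ 0)
    (hL : ∀ p : ℕ, p.Prime → LocalExp n B C p (padicValNat p d)) {p : ℕ} (hp : p.Prime)
    (hpf : p ∣ sqPart B)
    (h : padicValNat p d = 0 ∨ n ∣ 2 * padicValNat p d - padicValInt p C) :
    padicValInt p (newC n B C d) = 0 := by
  have h1 := padicValInt_newC hn hB hC hd hL hp
  have h2 := padicValInt_le_one hC hred hp hpf
  rw [padicValNat_zFactor hd hp, if_pos hpf] at h1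
  rcases localExp_cases hB hp (hL p hp) with h3 | h3 | h3
  · exact absurd hpf h3.1
  · rw [h3.2.1, h3.2.2] at h1
    simpa using h1
  · obtain ⟨k, hk⟩ := h.resolve_left h3.2.1.ne'
    rw [hk] at h1
    have h4 : (n * k) ⌈/⌉ n = k := by simpa using smul_ceilDiv (β := ℕ) hn k
    rw [h4, ← hk] at h1
    omega

theorem gcd_sqPart_newB_newC (hn : 0 < n) (hB : B ≠ 0) (hC : C ≠ 0)
    (hred : ∀ p : ℕ, p.Prime → ¬ ((p : ℤ) ^ 2 ∣ B ∧ (p : ℤ) ^ 2 ∣ C)) (hd : d ≠ 0)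
    (hL : ∀ p : ℕ, p.Prime → LocalExp n B C p (padicValNat p d)) :
    Int.gcd (sqPart (newB B d)) (newC n B C d) = 1 := by
  rw [gcd_eq_one_iff_forall_prime]
  rintro p hp ⟨h1, h2⟩
  have := Fact.mk hp
  have h1' : p ∣ sqPart (newB B d) := by exact_mod_cast h1
  have hf := sqPart_eq_fFactor_mul hB hd hL
  have hpf : p ∣ sqPart B := hf ▸ h1'.mul_left _
  have hnB := newB_ne_zero hB hd hL
  have h3 : padicValNat p d < padicValNat p (sqPart B) := by
    rw [hf, padicValNat.mul fFactor_ne_zero (sqPart_pos hnB).ne', padicValNat_fFactor hd hp,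
      if_pos hpf]
    have := (padicValNat_sqPart_pos_iff hnB hp).2 h1'
    omega
  have h4 : padicValInt p (newC n B C d) = 0 := by
    refine padicValInt_newC_eq_zero hn hB hC hred hd hL hp hpf ?_
    rcases localExp_cases hB hp (hL p hp) with h | h | h
    · exact absurd hpf h.1
    · exact Or.inl h.2.1
    · exact Or.inr (h.2.2.2.resolve_left h3.ne)
  have h5 := (pow_dvd_iff_le_padicValInt hp (newC_ne_zero hn hB hC hd hL) (k := 1)).1
    (by simpa using h2)
  omega

theorem redData_finite (hB : B ≠ 0) (hC : C ≠ 0) : (RedData n B C).Finite := by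
  have hk : Finite Kind := Finite.of_injective (fun κ : Kind => κ = Kind.star)
    (by intro a b; cases a <;> cases b <;> simp)
  have h0 : sqPart B * C.natAbs ≠ 0 := mul_ne_zero (sqPart_pos hB).ne' (by simpa using hC)
  refine ((Nat.divisors (sqPart B * C.natAbs)).finite_toSet.prod (Set.finite_univ (α := Kind))).subset ?_
  rintro ⟨d, κ⟩ ⟨hd, hL, -⟩
  refine ⟨?_, Set.mem_univ _⟩
  simp only [Finset.mem_coe, Nat.mem_divisors]
  refine ⟨dvd_of_forall_padicValNat_le hd.ne' h0 fun p hp => ?_, h0⟩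
  have := Fact.mk hp
  rw [padicValNat.mul (sqPart_pos hB).ne' (by simpa using hC)]
  change _ ≤ _ + padicValInt p C
  rcases localExp_cases hB hp (hL p hp) with h | h | h <;> simp only at h <;> omega

/-! ### Solutions of the original equation and of the cascade -/

theorem baseCond_star_iff {x y z : ℤ} : BaseCond B Kind.star (x, y, z) ↔
    ∀ p : ℕ, p.Prime → ¬ ((p : ℤ) ∣ 2 * x ∧ (p : ℤ) ^ 2 ∣ x ^ 2 + B * y ^ 2) :=
  forall₂_congr fun _ hp => star_zero_iff hp _

theorem baseCond_tilde_iff {x y z : ℤ} : BaseCond B Kind.tilde (x, y, z) ↔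
    ((4 : ℤ) ∣ x ^ 2 + B * y ^ 2 ∧ ¬ (2 : ℤ) ∣ x) ∧
    ∀ p : ℕ, p.Prime → p ≠ 2 → ¬ ((p : ℤ) ∣ 2 * x ∧ (p : ℤ) ^ 2 ∣ x ^ 2 + B * y ^ 2) :=
  and_congr (tildeStarTwo_iff _) (forall₂_congr fun _ hp => imp_congr Iff.rfl (star_zero_iff hp _))

/-- A point of one of the two types has coprime `x` and `y`. -/
theorem BaseCond.not_dvd {κ : Kind} {x y z : ℤ} (h : BaseCond B κ (x, y, z)) {p : ℕ}
    (hp : p.Prime) : ¬ ((p : ℤ) ∣ x ∧ (p : ℤ) ∣ y) := by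
  rintro ⟨h1, h2⟩
  have h3 : (p : ℤ) ∣ 2 * x ∧ (p : ℤ) ^ 2 ∣ x ^ 2 + B * y ^ 2 := ⟨h1.mul_left _,
    dvd_add (pow_dvd_pow_of_dvd h1 2) ((pow_dvd_pow_of_dvd h2 2).mul_left _)⟩
  cases κ with
  | star => exact baseCond_star_iff.1 h p hp h3
  | tilde =>
    obtain ⟨⟨-, h4⟩, h5⟩ := baseCond_tilde_iff.1 h
    by_cases hp2 : p = 2
    · exact h4 (by simpa [hp2] using h1)
    · exact h5 p hp hp2 h3

theorem gcd_gcd_eq_one {x y z : ℤ} (h : ∀ p : ℕ, p.Prime → ¬ ((p : ℤ) ∣ x ∧ (p : ℤ) ∣ y)) :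
    Int.gcd (Int.gcd x y) z = 1 := by
  rw [gcd_eq_one_iff_forall_prime.2 h]
  simp

theorem gcd_natCast_eq_one_iff {y : ℤ} {N : ℕ} :
    Int.gcd y N = 1 ↔ ∀ p : ℕ, p.Prime → p ∣ N → ¬ (p : ℤ) ∣ y := by
  rw [gcd_eq_one_iff_forall_prime]
  refine forall₂_congr fun p _ => ?_
  rw [Int.natCast_dvd_natCast]
  tauto

theorem eq_mul_offFactor (hd : d ≠ 0) : (d : ℤ) = fFactor B d * offFactor B d := by
  exact_mod_cast (fFactor_mul_offFactor hd).symm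

/-- A point attached to a cascade datum gives a primitive solution of the original equation. -/
theorem points_nonempty_of_basePoints (hn : 0 < n) (hB : B ≠ 0) (hC : C ≠ 0) (hd : d ≠ 0)
    (hL : ∀ p : ℕ, p.Prime → LocalExp n B C p (padicValNat p d)) {κ : Kind}
    (h : (BasePoints n (newB B d) (newC n B C d) κ (yMod B d) (zMod B d)).Nonempty) :
    (Points n B C).Nonempty := by
  obtain ⟨⟨x, y, z⟩, ⟨-, heq⟩, hbase, hy, hz⟩ := h
  simp only at heq hy hz
  rw [gcd_natCast_eq_one_iff] at hy hz
  have h1 := fFactor_sq_mul_newB hB hd hL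
  have h2 := sq_mul_newC hn hB hC hd hL
  have h3 := eq_mul_offFactor (B := B) hd
  refine ⟨(d * x, offFactor B d * y, zFactor n B C d * z), ?_, ?_⟩
  · simp only
    rw [Int.gcd_assoc, gcd_eq_one_iff_forall_prime]
    rintro p hp ⟨hpx, hpyz⟩
    rw [Int.dvd_coe_gcd_iff] at hpyz
    obtain ⟨hpy, hpz⟩ := hpyz
    have hp' := Nat.prime_iff_prime_int.1 hp
    by_cases hph : p ∣ offFactor B d
    · have hph' := (dvd_offFactor_iff hd hp).1 hph
      refine (hp'.dvd_or_dvd hpz).elim (fun h => ?_) (hz p hp ((dvd_zMod_iff hd hp).2 hph'))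
      have h4 : padicValNat p (zFactor n B C d) = 0 := by
        rw [padicValNat_zFactor hd hp, if_neg hph'.2]
      have := Fact.mk hp
      exact (dvd_iff_padicValNat_ne_zero zFactor_ne_zero).1 (by exact_mod_cast h) h4
    · have hpy' := (hp'.dvd_or_dvd hpy).resolve_left fun h => hph (by exact_mod_cast h)
      have hpd : p ∣ d := by
        exact_mod_cast (hp'.dvd_or_dvd hpx).resolve_right fun h => hbase.not_dvd hp ⟨h, hpy'⟩
      refine hy p hp ((dvd_yMod_iff hd hp).2 ⟨hpd, ?_⟩) hpy'
      by_contra hpf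
      exact hph ((dvd_offFactor_iff hd hp).2 ⟨hpd, hpf⟩)
  · simp only
    linear_combination (d : ℤ) ^ 2 * heq + z ^ n * h2 - (offFactor B d * y) ^ 2 * h1
      - y ^ 2 * newB B d * (d + fFactor B d * offFactor B d) * h3

/-- The exponents `s = v_p(d)` of the largest common divisor `d` of `x` and `f y` satisfy the local
conditions. If `s > 0`, then `p ∤ y` for `p ∣ f`, as `gcd(B, C)` is squarefree, and `p ∤ z` for
`p ∤ f`, as the solution is primitive. If `p ∣ f` and `0 < s < v_p(f)`, then `v_p(x) = s`, so that `v_p(C) + n v_p(z) = 2 s`. -/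
theorem localExp_gcd (hB : B ≠ 0) (hC : C ≠ 0)
    (hred : ∀ p : ℕ, p.Prime → ¬ ((p : ℤ) ^ 2 ∣ B ∧ (p : ℤ) ^ 2 ∣ C)) {x y z : ℤ} (hz : z ≠ 0)
    (hgcd : ∀ p : ℕ, p.Prime → (p : ℤ) ∣ x → (p : ℤ) ∣ y → ¬ (p : ℤ) ∣ z)
    (heq : x ^ 2 + B * y ^ 2 = C * z ^ n) (hd : d ≠ 0)
    (hdvd : ∀ {k : ℕ}, k ∣ d ↔ (k : ℤ) ∣ x ∧ (k : ℤ) ∣ sqPart B * y) {p : ℕ} (hp : p.Prime) :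
    LocalExp n B C p (padicValNat p d) ∧
    (p ∣ d → (p ∣ sqPart B → ¬ (p : ℤ) ∣ y) ∧ (¬ p ∣ sqPart B → ¬ (p : ℤ) ∣ z)) ∧
    (p ∣ sqPart B → 2 * padicValNat p d ≤ padicValInt p C + n * padicValInt p z) := by
  have := Fact.mk hp
  have hp' := Nat.prime_iff_prime_int.1 hp
  have hpos := padicValNat_sqPart_pos_iff hB hp
  have hf := sqPart_pos hB
  have hCz : C * z ^ n ≠ 0 := mul_ne_zero hC (pow_ne_zero _ hz)
  have hv : padicValInt p (C * z ^ n) = padicValInt p C + n * padicValInt p z := by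
    rw [padicValInt.mul hC (pow_ne_zero _ hz), padicValInt, padicValInt, padicValInt,
      Int.natAbs_pow, padicValNat.pow]
  set s := padicValNat p d with hs
  set r := padicValNat p (sqPart B) with hr
  have hsx : (p : ℤ) ^ s ∣ x ∧ (p : ℤ) ^ s ∣ sqPart B * y := by
    have := hdvd.1 (pow_padicValNat_dvd (p := p) (n := d))
    exact_mod_cast this
  have hs0 : s ≠ 0 ↔ p ∣ d := by rw [hs, ← dvd_iff_padicValNat_ne_zero hd]
  by_cases hpf : p ∣ sqPart B
  · have hr0 : 0 < r := hpos.2 hpf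
    have hpB : (p : ℤ) ∣ B := (dvd_pow_self _ two_ne_zero).trans (sq_dvd_of_dvd_sqPart hpf)
    have hpy : p ∣ d → ¬ (p : ℤ) ∣ y := by
      intro hpd hpy
      have hpx := (hdvd.1 hpd).1
      have h1 : (p : ℤ) ^ 2 ∣ C * z ^ n := heq ▸ dvd_add (pow_dvd_pow_of_dvd hpx 2)
        ((sq_dvd_of_dvd_sqPart hpf).mul_right _)
      refine hred p hp ⟨sq_dvd_of_dvd_sqPart hpf, IsCoprime.dvd_of_dvd_mul_right ?_ h1⟩
      exact IsCoprime.pow (hp'.coprime_iff_not_dvd.2 (hgcd p hp hpx hpy))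
    have hsr : s ≤ r := by
      by_cases hs' : s = 0
      · omega
      · have h1 : IsCoprime ((p : ℤ) ^ s) y :=
          IsCoprime.pow_left (hp'.coprime_iff_not_dvd.2 (hpy (hs0.1 hs')))
        have h2 : (p : ℤ) ^ s ∣ sqPart B := h1.dvd_of_dvd_mul_right hsx.2
        exact (padicValNat_dvd_iff_le hf.ne').1 (by exact_mod_cast h2)
    have hrB : ∀ k ≤ r, (p : ℤ) ^ (2 * k) ∣ B := by
      intro k hk
      have h1 : p ^ k ∣ sqPart B := (padicValNat_dvd_iff_le hf.ne').2 hk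
      rw [mul_comm, pow_mul, ← Nat.cast_pow]
      exact sq_dvd_of_dvd_sqPart h1
    have hsx2 : (p : ℤ) ^ (2 * s) ∣ x ^ 2 := by
      rw [mul_comm, pow_mul]; exact pow_dvd_pow_of_dvd hsx.1 2
    have hsC : (p : ℤ) ^ (2 * s) ∣ C * z ^ n :=
      heq ▸ dvd_add hsx2 ((hrB s hsr).mul_right _)
    have hle : 2 * s ≤ padicValInt p C + n * padicValInt p z := by
      rw [← hv, ← pow_dvd_iff_le_padicValInt hp hCz]; exact hsC
    refine ⟨Or.inr ⟨hr0, ?_⟩, fun h => ⟨fun _ => hpy h, fun h => absurd hpf h⟩, fun _ => hle⟩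
    by_cases hs' : s = 0
    · refine Or.inl ⟨hs', ?_⟩
      by_contra hc
      have hpC : (p : ℤ) ∣ C := by
        have := (pow_dvd_iff_le_padicValInt hp hC (k := 1)).2 (by omega)
        simpa using this
      have hpx : (p : ℤ) ∣ x := hp'.dvd_of_dvd_pow (n := 2)
        ((dvd_add_left (hpB.mul_right _)).1 (heq ▸ hpC.mul_right _))
      exact hs0.2 (hdvd.2 ⟨hpx, Dvd.dvd.mul_right (by exact_mod_cast hpf) _⟩) hs'
    · refine Or.inr ⟨Nat.pos_of_ne_zero hs', hsr, or_iff_not_imp_left.2 fun hne => ?_⟩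
      have hlt : s + 1 ≤ r := by omega
      have hx : ¬ (p : ℤ) ^ (s + 1) ∣ x := by
        intro h
        have h1 : p ^ (s + 1) ∣ sqPart B := (padicValNat_dvd_iff_le hf.ne').2 hlt
        have h2 : p ^ (s + 1) ∣ d := hdvd.2 ⟨by exact_mod_cast h,
          Dvd.dvd.mul_right (by exact_mod_cast h1) _⟩
        have := (padicValNat_dvd_iff_le hd).1 h2
        omega
      have h1 : ¬ (p : ℤ) ^ (2 * s + 1) ∣ C * z ^ n := by
        intro h
        have h2 : (p : ℤ) ^ (2 * s + 1) ∣ x ^ 2 :=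
          (dvd_add_left ((((pow_dvd_pow (p : ℤ) (by omega)).trans (hrB _ hlt)).mul_right _))).1
            (heq ▸ h)
        obtain ⟨w, rfl⟩ := hsx.1
        rw [mul_pow, ← pow_mul, mul_comm s 2, pow_succ] at h2
        have h3 := (mul_dvd_mul_iff_left (pow_ne_zero _ hp'.ne_zero)).1 h2
        exact hx (pow_succ (p : ℤ) s ▸ mul_dvd_mul_left _ (hp'.dvd_of_dvd_pow h3))
      rw [pow_dvd_iff_le_padicValInt hp hCz, hv] at h1
      exact ⟨padicValInt p z, by omega⟩
  · have hr0 : r = 0 := by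
      by_contra h
      exact hpf (hpos.1 (Nat.pos_of_ne_zero h))
    have hcop : ¬ (p : ℤ) ∣ sqPart B := by exact_mod_cast hpf
    have hsy : (p : ℤ) ^ s ∣ y :=
      (IsCoprime.pow_left (hp'.coprime_iff_not_dvd.2 hcop)).dvd_of_dvd_mul_left hsx.2
    have hpz : p ∣ d → ¬ (p : ℤ) ∣ z := fun h => by
      have h1 : (p : ℤ) ∣ (p : ℤ) ^ s := dvd_pow_self _ (hs0.2 h)
      exact hgcd p hp (h1.trans hsx.1) (h1.trans hsy)
    refine ⟨Or.inl ⟨hr0, ?_⟩, fun h => ⟨fun h => absurd h hpf, fun _ => hpz h⟩,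
      fun h => absurd h hpf⟩
    by_cases hs' : s = 0
    · omega
    · have h1 : (p : ℤ) ^ (2 * s) ∣ C * z ^ n := by
        rw [mul_comm, pow_mul, ← heq]
        exact dvd_add (pow_dvd_pow_of_dvd hsx.1 2) ((pow_dvd_pow_of_dvd hsy 2).mul_left _)
      rw [← pow_dvd_iff_le_padicValInt hp hC]
      refine IsCoprime.dvd_of_dvd_mul_right ?_ h1
      exact IsCoprime.pow (hp'.coprime_iff_not_dvd.2 (hpz (hs0.1 hs')))

theorem z_ne_zero_of_mem_points (hn : n ≠ 0) (hsq : ¬ IsSquare (-B)) {x y z : ℤ}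
    (h : (x, y, z) ∈ Points n B C) : z ≠ 0 := by
  rintro rfl
  obtain ⟨hgcd, heq⟩ := h
  simp only [zero_pow hn, mul_zero] at heq hgcd
  have hy : y ≠ 0 := by
    rintro rfl
    have : x = 0 := by simpa using heq
    simp [this] at hgcd
  obtain ⟨k, rfl⟩ : y ∣ x := (Int.pow_dvd_pow_iff two_ne_zero).1 ⟨-B, by linarith⟩
  exact hsq ⟨k, mul_left_cancel₀ (pow_ne_zero 2 hy) (by linarith)⟩

theorem eight_dvd_sub_sqfPart {B : ℤ} (hB : ¬ (2 : ℤ) ∣ B) :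
    ¬ (2 : ℤ) ∣ sqPart B ∧ (8 : ℤ) ∣ B - sqfPart B := by
  have hB' := sqPart_sq_mul_sqfPart B
  have hf : ¬ (2 : ℤ) ∣ sqPart B := fun h => hB <| by
    rw [← hB']; exact (dvd_pow h two_ne_zero).mul_right _
  refine ⟨hf, ?_⟩
  have := (eight_dvd_sq_sub_one hf).mul_right (sqfPart B)
  rwa [sub_mul, hB', one_mul] at this

/-- The conditions on the type `*~^0` hold as soon as there are points of this type. -/
theorem kindOK_tilde {B' C' : ℤ} {x y z : ℤ} {M : ℕ}
    (heq : x ^ 2 + B' * y ^ 2 = C' * z ^ n) (hx : ¬ (2 : ℤ) ∣ x)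
    (h4 : (4 : ℤ) ∣ x ^ 2 + B' * y ^ 2) (hz : Even M → ¬ (2 : ℤ) ∣ z) : KindOK B' C' M Kind.tilde := by
  obtain ⟨hy, hB⟩ := odd_coeff_of_four_dvd hx h4
  obtain ⟨hf, h8⟩ := eight_dvd_sub_sqfPart (B := B') (by omega)
  refine ⟨?_, ?_, fun hM => ?_⟩
  · simp only [Int.ModEq]; omega
  · refine (Int.odd_coe_nat _).1 ?_
    exact Int.not_even_iff_odd.1 fun h => hf h.two_dvd
  · have hzn : IsCoprime (2 : ℤ) (z ^ n) :=
      IsCoprime.pow_right (Int.prime_two.coprime_iff_not_dvd.2 (hz hM))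
    have h4C : (4 : ℤ) ∣ C' := by
      refine IsCoprime.dvd_of_dvd_mul_right (z := z ^ n) ?_ (heq ▸ h4)
      exact (show (4 : ℤ) = 2 ^ 2 by norm_num) ▸ hzn.pow_left
    have h1 : (8 : ℤ) ∣ C' * z ^ n - (1 + B') := by
      have : C' * z ^ n - (1 + B') = (x ^ 2 - 1) + B' * (y ^ 2 - 1) := by rw [← heq]; ring
      rw [this]
      exact dvd_add (eight_dvd_sq_sub_one hx) ((eight_dvd_sq_sub_one hy).mul_left _)
    by_cases h7 : (8 : ℤ) ∣ 1 + B'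
    · right
      refine ⟨by simp only [Int.ModEq]; omega, ?_⟩
      refine IsCoprime.dvd_of_dvd_mul_right (z := z ^ n) ?_ ((dvd_sub_left h7).1 h1)
      exact (show (8 : ℤ) = 2 ^ 3 by norm_num) ▸ hzn.pow_left
    · left
      refine ⟨by simp only [Int.ModEq]; omega, h4C, fun h => h7 ?_⟩
      exact (dvd_sub_right (h.mul_right _)).1 h1

/-- A primitive solution, divided by the largest common divisor `d` of `x` and `f y`, is a point
attached to a cascade datum. -/
theorem exists_basePoints_of_points (hn : n ≠ 0) (hB : B ≠ 0) (hC : C ≠ 0)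
    (hsq : ¬ IsSquare (-B))
    (hred : ∀ p : ℕ, p.Prime → ¬ ((p : ℤ) ^ 2 ∣ B ∧ (p : ℤ) ^ 2 ∣ C))
    (h : (Points n B C).Nonempty) : ∃ D ∈ RedData n B C,
      (BasePoints n (newB B D.1) (newC n B C D.1) D.2 (yMod B D.1) (zMod B D.1)).Nonempty := by
  obtain ⟨⟨x, y, z⟩, hP⟩ := h
  have hz := z_ne_zero_of_mem_points hn hsq hP
  obtain ⟨hgcd, heq⟩ := hP
  simp only at hgcd heq
  rw [Int.gcd_assoc, gcd_eq_one_iff_forall_prime] at hgcd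
  have hgcd' : ∀ p : ℕ, p.Prime → (p : ℤ) ∣ x → (p : ℤ) ∣ y → ¬ (p : ℤ) ∣ z :=
    fun p hp h1 h2 h3 => hgcd p hp ⟨h1, Int.dvd_coe_gcd h2 h3⟩
  have hf := sqPart_pos hB
  obtain ⟨d, hd⟩ : ∃ d, d = Int.gcd x (sqPart B * y) := ⟨_, rfl⟩
  have hd0 : d ≠ 0 := by
    rintro rfl
    obtain ⟨rfl, h1⟩ := Int.gcd_eq_zero_iff.1 hd.symm
    have hy : y = 0 := (mul_eq_zero.1 h1).resolve_left (by exact_mod_cast hf.ne')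
    subst hy
    exact mul_ne_zero hC (pow_ne_zero n hz) (by rw [← heq]; ring)
  have hdvd : ∀ {k : ℕ}, k ∣ d ↔ (k : ℤ) ∣ x ∧ (k : ℤ) ∣ sqPart B * y := fun {k} => by
    rw [hd, ← Int.natCast_dvd_natCast, Int.dvd_coe_gcd_iff]
  have hloc := fun p hp => localExp_gcd hB hC hred hz hgcd' heq hd0 hdvd (p := p) hp
  have hL : ∀ p : ℕ, p.Prime → LocalExp n B C p (padicValNat p d) := fun p hp => (hloc p hp).1
  have h1 := fFactor_sq_mul_newB hB hd0 hL
  have h2 := sq_mul_newC (Nat.pos_of_ne_zero hn) hB hC hd0 hL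
  have h3 := eq_mul_offFactor (B := B) hd0
  have h4 := sqPart_eq_fFactor_mul hB hd0 hL
  have hd0' : (d : ℤ) ≠ 0 := by exact_mod_cast hd0
  obtain ⟨x', hx'⟩ : (d : ℤ) ∣ x := (hdvd.1 dvd_rfl).1
  obtain ⟨y', hy'⟩ : (offFactor B d : ℤ) ∣ y := by
    have h5 : (offFactor B d : ℤ) ∣ sqPart B * y := (Dvd.intro_left _ h3.symm).trans (hdvd.1 dvd_rfl).2
    refine IsCoprime.dvd_of_dvd_mul_left (isCoprime_iff_forall_prime.2 ?_) h5
    rintro p hp ⟨h6, h7⟩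
    exact ((dvd_offFactor_iff hd0 hp).1 (by exact_mod_cast h6)).2 (by exact_mod_cast h7)
  obtain ⟨z', hz'⟩ : (zFactor n B C d : ℤ) ∣ z := by
    rw [Int.natCast_dvd]
    refine dvd_of_forall_padicValNat_le zFactor_ne_zero (by simpa using hz) fun p hp => ?_
    rw [padicValNat_zFactor hd0 hp]
    split_ifs with hpf
    · rw [ceilDiv_le_iff_le_mul (Nat.pos_of_ne_zero hn)]
      have := (hloc p hp).2.2 hpf
      change _ ≤ n * padicValInt p z
      omega
    · exact Nat.zero_le _
  have heq' : x' ^ 2 + newB B d * y' ^ 2 = newC n B C d * z' ^ n := by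
    refine mul_left_cancel₀ (pow_ne_zero 2 hd0') ?_
    rw [hx', hy', hz'] at heq
    linear_combination heq - z' ^ n * h2 + (offFactor B d * y') ^ 2 * h1
      + y' ^ 2 * newB B d * (d + fFactor B d * offFactor B d) * h3
  have hcop : ∀ p : ℕ, p.Prime → ¬ ((p : ℤ) ∣ x' ∧ (p : ℤ) ∣ sqPart (newB B d) * y') := by
    rintro p hp ⟨h5, h6⟩
    have h7 : d * p ∣ d := by
      refine hdvd.2 ⟨?_, ?_⟩
      · rw [hx', Nat.cast_mul]; exact mul_dvd_mul_left _ h5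
      · rw [hy', h4, Nat.cast_mul, Nat.cast_mul, h3]
        rw [mul_mul_mul_comm]
        exact mul_dvd_mul_left _ h6
    exact hp.one_lt.ne' (Nat.dvd_one.1 (Nat.dvd_of_mul_dvd_mul_left (Nat.pos_of_ne_zero hd0)
      (by rwa [mul_one])))
  have hnB := newB_ne_zero hB hd0 hL
  have hst : ∀ p : ℕ, p.Prime → (p : ℤ) ∣ x' → ¬ (p : ℤ) ^ 2 ∣ x' ^ 2 + newB B d * y' ^ 2 := by
    intro p hp h5 h6
    have h7 : (p : ℤ) ^ 2 ∣ (sqPart (newB B d) * y') ^ 2 * sqfPart (newB B d) := by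
      rw [mul_pow, mul_right_comm, sqPart_sq_mul_sqfPart]
      exact (dvd_add_right (pow_dvd_pow_of_dvd h5 2)).1 h6
    refine not_sq_dvd_sqfPart hnB hp (IsCoprime.dvd_of_dvd_mul_left ?_ h7)
    exact ((Nat.prime_iff_prime_int.1 hp).coprime_iff_not_dvd.2 fun h => hcop p hp ⟨h5, h⟩).pow
  have hodd : ∀ p : ℕ, p.Prime → p ≠ 2 → (p : ℤ) ∣ 2 * x' → (p : ℤ) ∣ x' := fun p hp hp2 h =>
    ((Nat.prime_iff_prime_int.1 hp).dvd_or_dvd h).resolve_left fun h => hp2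
      ((Nat.prime_dvd_prime_iff_eq hp Nat.prime_two).1 (by exact_mod_cast h))
  have hyM : Int.gcd y' (yMod B d) = 1 := by
    rw [gcd_natCast_eq_one_iff]
    intro p hp hpM h
    obtain ⟨h5, h6⟩ := (dvd_yMod_iff hd0 hp).1 hpM
    exact ((hloc p hp).2.1 h5).1 h6 (hy' ▸ h.mul_left _)
  have hzM' : ∀ p : ℕ, p.Prime → p ∣ zMod B d → ¬ (p : ℤ) ∣ z' := by
    intro p hp hpM h
    obtain ⟨h5, h6⟩ := (dvd_zMod_iff hd0 hp).1 hpM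
    exact ((hloc p hp).2.1 h5).2 h6 (hz' ▸ h.mul_left _)
  have hzM : Int.gcd z' (zMod B d) = 1 := gcd_natCast_eq_one_iff.2 hzM'
  have hgcd'' : Int.gcd (Int.gcd x' y') z' = 1 :=
    gcd_gcd_eq_one fun p hp h => hcop p hp ⟨h.1, h.2.mul_left _⟩
  by_cases h4' : (4 : ℤ) ∣ x' ^ 2 + newB B d * y' ^ 2
  · have hx2 : ¬ (2 : ℤ) ∣ x' := fun h => hst 2 Nat.prime_two h (by norm_num [h4'])
    refine ⟨(d, Kind.tilde), ⟨Nat.pos_of_ne_zero hd0, hL, ?_⟩, (x', y', z'), ⟨hgcd'', heq'⟩, ?_,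
      hyM, hzM⟩
    · exact kindOK_tilde heq' hx2 h4' fun h => hzM' 2 Nat.prime_two h.two_dvd
    · exact baseCond_tilde_iff.2 ⟨⟨h4', hx2⟩, fun p hp hp2 h => hst p hp (hodd p hp hp2 h.1) h.2⟩
  · refine ⟨(d, Kind.star), ⟨Nat.pos_of_ne_zero hd0, hL, trivial⟩, (x', y', z'), ⟨hgcd'', heq'⟩, ?_,
      hyM, hzM⟩
    refine baseCond_star_iff.2 fun p hp h => ?_
    by_cases hp2 : p = 2
    · subst hp2; exact h4' (by simpa using h.2)
    · exact hst p hp (hodd p hp hp2 h.1) h.2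

/-! ### Coprimality conditions on the points of a cascade datum -/

/-- For odd `f`, the condition `B₀ ≡ 7 (mod 8)` on the modulus can be read off from `B`. -/
theorem allowedModulus_odd {B C : ℤ} {M : ℕ} (h : AllowedModulus B C Kind.tilde M)
    (h8 : (8 : ℤ) ∣ B + 1) (hC : ¬ (8 : ℤ) ∣ C) : Odd M := by
  refine h.2 rfl ?_ hC
  have := (eight_dvd_sub_sqfPart (B := B) (by omega)).2
  simp only [Int.ModEq]
  omega

/-- A point of either type can be moved to one of the same type with `z` coprime to an allowed modulus
`M` and `y` coprime to `N`. The prime `2` needs no condition on `z`: for the type `*^0`, `z` is odd,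
and for the type `*~^0`, `y` is odd anyway. -/
theorem basePoints_nonempty_of_baseCond {n : ℕ} (hn : Odd n) (hn3 : 3 ≤ n) {B C : ℤ} (hB : B ≠ 0)
    (hC : C ≠ 0) (hsq : ¬ IsSquare (-B)) {κ : Kind} {x y z : ℤ} (hP : (x, y, z) ∈ Points n B C)
    (hbase : BaseCond B κ (x, y, z)) {M N : ℕ} (hM : AllowedModulus B C κ M) (hN : N ≠ 0)
    (hNz : ∀ p : ℕ, p.Prime → p ∣ N → p ≠ 2 → ¬ (p : ℤ) ∣ z)
    (hNn : ∀ p : ℕ, p.Prime → p ∣ N → (p : ℤ) ∣ B → p ∣ n → (p : ℤ) ∣ C) :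
    (BasePoints n B C κ N M).Nonempty := by
  have hz := z_ne_zero_of_mem_points (by omega) hsq hP
  cases κ with
  | star =>
    obtain ⟨x', y', z', heq, hst, hzM, hyN⟩ := exists_star_point hn hn3 hB hC hP.2
      (baseCond_star_iff.1 hbase) hM.1.ne' hN hNz hNn
    have hb : BaseCond B Kind.star (x', y', z') := baseCond_star_iff.2 hst
    exact ⟨(x', y', z'), ⟨gcd_gcd_eq_one fun p hp => hb.not_dvd hp, heq⟩, hb,
      gcd_natCast_eq_one_iff.2 hyN, gcd_natCast_eq_one_iff.2 hzM⟩
  | tilde =>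
    obtain ⟨⟨h4, h2⟩, hst⟩ := baseCond_tilde_iff.1 hbase
    obtain ⟨x', y', z', heq, hx', h4', hst', hzM, hyN⟩ := exists_tilde_point hn hn3 hB hC hz hP.2
      h2 h4 hst hM.1.ne' hN (allowedModulus_odd hM) hNz hNn
    have hb : BaseCond B Kind.tilde (x', y', z') := baseCond_tilde_iff.2 ⟨⟨h4', hx'⟩, hst'⟩
    exact ⟨(x', y', z'), ⟨gcd_gcd_eq_one fun p hp => hb.not_dvd hp, heq⟩, hb,
      gcd_natCast_eq_one_iff.2 hyN, gcd_natCast_eq_one_iff.2 hzM⟩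

/-- Outside the excluded set and the borderline pairs, the condition `gcd(y, N) = 1` is automatic at
the primes `p ∣ gcd(n, B')`, as these divide `C'`. -/
theorem dvd_newC_of_dvd_yMod (hn : Odd n) (hB : B ≠ 0) (hC : C ≠ 0)
    (hred : ∀ p : ℕ, p.Prime → ¬ ((p : ℤ) ^ 2 ∣ B ∧ (p : ℤ) ^ 2 ∣ C)) (hd : d ≠ 0)
    (hL : ∀ p : ℕ, p.Prime → LocalExp n B C p (padicValNat p d)) {p : ℕ} (hp : p.Prime)
    (hpy : p ∣ yMod B d) (hpB : (p : ℤ) ∣ newB B d)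
    (hexc₀ : padicValInt p C = 0 → padicValNat p (sqPart B) < n)
    (hexc₁ : padicValInt p C = 1 → 2 * padicValNat p (sqPart B) ≤ n + 1)
    (hbor : (p : ℤ) ∣ sqfPart B → 2 * padicValNat p (sqPart B) ≠ padicValInt p C + n) :
    (p : ℤ) ∣ newC n B C d := by
  have := Fact.mk hp
  have hn0 := hn.pos
  obtain ⟨hpd, hpf⟩ := (dvd_yMod_iff hd hp).1 hpy
  have hc := padicValInt_le_one hC hred hp hpf
  have hs := (dvd_iff_padicValNat_ne_zero hd).1 hpd
  have hv := padicValInt_newC hn0 hB hC hd hL hp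
  rw [padicValNat_zFactor hd hp, if_pos hpf] at hv
  have h1 : ¬ n ∣ 2 * padicValNat p d - padicValInt p C := by
    intro hdvd
    have hsr : padicValNat p d ≤ padicValNat p (sqPart B) := by
      rcases localExp_cases hB hp (hL p hp) with h | h | h
      · exact absurd hpf h.1
      · omega
      · exact h.2.2.1
    obtain ⟨m, hm⟩ := hn
    rcases Nat.le_one_iff_eq_zero_or_eq_one.1 hc with h0 | h0
    · rw [h0, Nat.sub_zero] at hdvd
      have := hexc₀ h0
      have hco : Nat.Coprime n 2 := Nat.Coprime.symm ((Nat.coprime_two_left).2 ⟨m, hm⟩)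
      have := Nat.le_of_dvd (by omega) (hco.dvd_of_dvd_mul_left hdvd)
      omega
    · have := hexc₁ h0
      rw [h0] at hdvd hbor
      have := Nat.le_of_dvd (by omega) hdvd
      have hr : 2 * padicValNat p (sqPart B) = 1 + n := by omega
      refine hbor ?_ hr
      -- here `s = r`, so `p` does not divide the square part of the new coefficient
      have hnB := newB_ne_zero hB hd hL
      have h2 := congrArg (padicValNat p) (sqPart_eq_fFactor_mul hB hd hL)
      rw [padicValNat.mul fFactor_ne_zero (sqPart_pos hnB).ne', padicValNat_fFactor hd hp,
        if_pos hpf] at h2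
      have h3 := (pow_dvd_iff_le_padicValInt hp hnB (k := 1)).1 (by simpa using hpB)
      rw [padicValInt_eq_sqPart hnB hp, sqfPart_newB hB hd hL] at h3
      have := (pow_dvd_iff_le_padicValInt hp (sqfPart_ne_zero hB) (k := 1)).2 (by omega)
      simpa using this
  have h2 : padicValInt p (newC n B C d) ≠ 0 := by
    intro h0
    rw [h0] at hv
    exact h1 ⟨(2 * padicValNat p d - padicValInt p C) ⌈/⌉ n, by omega⟩
  have := (pow_dvd_iff_le_padicValInt hp (newC_ne_zero hn0 hB hC hd hL) (k := 1)).2 (by omega)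
  simpa using this

/-- For a cascade datum, the two coprimality conditions can be replaced by the existence of points
of the same type with `z` coprime to any prescribed modulus. -/
theorem basePoints_nonempty_iff (hn : Odd n) (hn3 : 3 ≤ n) (hB : B ≠ 0) (hC : C ≠ 0)
    (hsq : ¬ IsSquare (-B)) (hd : d ≠ 0)
    (hL : ∀ p : ℕ, p.Prime → LocalExp n B C p (padicValNat p d)) {κ : Kind}
    (hκ : KindOK (newB B d) (newC n B C d) (zMod B d) κ)
    (hNn : ∀ p : ℕ, p.Prime → p ∣ yMod B d → (p : ℤ) ∣ newB B d → p ∣ n → (p : ℤ) ∣ newC n B C d) :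
    (BasePoints n (newB B d) (newC n B C d) κ (yMod B d) (zMod B d)).Nonempty ↔
      ∀ M : ℕ, AllowedModulus (newB B d) (newC n B C d) κ M →
        (BasePoints n (newB B d) (newC n B C d) κ 1 M).Nonempty := by
  have hnB := newB_ne_zero hB hd hL
  have hnC := newC_ne_zero hn.pos hB hC hd hL
  have hnsq : ¬ IsSquare (-newB B d) := by
    rintro ⟨k, hk⟩
    exact hsq ⟨fFactor B d * k, by
      linear_combination (fFactor B d : ℤ) ^ 2 * hk + fFactor_sq_mul_newB hB hd hL⟩
  constructor
  · rintro ⟨⟨x, y, z⟩, hP, hbase, -, -⟩ M hM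
    refine basePoints_nonempty_of_baseCond hn hn3 hnB hnC hnsq hP hbase hM one_ne_zero ?_ ?_
    · exact fun p hp h => absurd (Nat.dvd_one.1 h) hp.one_lt.ne'
    · exact fun p hp h => absurd (Nat.dvd_one.1 h) hp.one_lt.ne'
  -- `z` is made coprime to `M'` first: moving can then prescribe `y` at the odd primes of `yMod`
  · intro h
    set M' := ∏ p ∈ (primesOfF B d).erase 2, p with hM'
    have hM'p : ∀ p ∈ (primesOfF B d).erase 2, p.Prime := fun p hp =>
      (mem_primesOfF.1 (Finset.mem_of_mem_erase hp)).1.1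
    have hM'0 : M' ≠ 0 := Finset.prod_ne_zero_iff.2 fun p hp => (hM'p p hp).ne_zero
    have hM'odd : Odd M' := by
      rw [← Nat.not_even_iff_odd, even_iff_two_dvd, hM', dvd_prod_id_iff hM'p Nat.prime_two]
      simp
    have hzodd : κ = Kind.tilde → sqfPart (newB B d) ≡ 7 [ZMOD 8] →
        ¬ (8 : ℤ) ∣ newC n B C d → Odd (zMod B d) := by
      rintro rfl h7 h8
      refine Nat.not_even_iff_odd.1 fun hev => ?_
      rcases hκ.2.2 hev with h3 | h3
      · have := h7.symm.trans h3.1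
        simp [Int.ModEq] at this
      · exact h8 h3.2
    obtain ⟨⟨x, y, z⟩, hP, hbase, -, hz⟩ := h (zMod B d * M')
      ⟨Nat.pos_of_ne_zero (mul_ne_zero zMod_ne_zero hM'0), fun h1 h2 h3 =>
        (hzodd h1 h2 h3).mul hM'odd⟩
    rw [gcd_natCast_eq_one_iff] at hz
    refine basePoints_nonempty_of_baseCond hn hn3 hnB hnC hnsq hP hbase
      ⟨Nat.pos_of_ne_zero zMod_ne_zero, hzodd⟩ yMod_ne_zero (fun p hp hpy hp2 => hz p hp ?_) hNn
    refine Dvd.dvd.mul_left ((dvd_prod_id_iff hM'p hp).2 (Finset.mem_erase.2 ⟨hp2, ?_⟩)) _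
    obtain ⟨h1, h2⟩ := (dvd_yMod_iff hd hp).1 hpy
    exact mem_primesOfF.2 ⟨⟨hp, h1, hd⟩, h2⟩

end

/-! ### The density of the excluded set -/

/-- The square `[-T, T] × [-T, T]`. -/
def box (T : ℕ) : Set (ℤ × ℤ) :=
  Set.Icc (-(T : ℤ)) T ×ˢ Set.Icc (-(T : ℤ)) T

theorem box_finite (T : ℕ) : (box T).Finite :=
  (Set.finite_Icc _ _).prod (Set.finite_Icc _ _)

theorem mem_box {T : ℕ} {Q : ℤ × ℤ} :
    Q ∈ box T ↔ (-(T : ℤ) ≤ Q.1 ∧ Q.1 ≤ T) ∧ -(T : ℤ) ≤ Q.2 ∧ Q.2 ≤ T :=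
  Iff.rfl

theorem abs_card_modEq_sub_le (m : ℕ) (hm : 0 < m) (v : ℤ) (T : ℕ) :
    |(((Finset.Icc (-(T : ℤ)) T).filter (fun x => x ≡ v [ZMOD m])).card : ℝ) - (2 * T + 1) / m| ≤ 1 := by
  have h0 : Finset.Icc (-(T : ℤ)) T = Finset.Ioc (-(T : ℤ) - 1) T := by
    ext; simp only [Finset.mem_Icc, Finset.mem_Ioc]; omega
  have h1 := Int.Ioc_filter_modEq_card (-(T : ℤ) - 1) T (r := m) (by exact_mod_cast hm) v
  rw [h0]
  have hm' : (0 : ℚ) < m := by exact_mod_cast hm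
  set x : ℚ := (((T : ℤ) : ℚ) - v) / ((m : ℤ) : ℚ) with hx
  set y : ℚ := (((-(T : ℤ) - 1 : ℤ) : ℚ) - v) / ((m : ℤ) : ℚ) with hy
  have hxy : x - y = (2 * T + 1) / m := by
    rw [hx, hy]; push_cast; field_simp; ring
  have hle : ⌊y⌋ ≤ ⌊x⌋ := Int.floor_le_floor (by
    have : (0 : ℚ) ≤ (2 * T + 1) / m := by positivity
    linarith)
  rw [max_eq_left (by linarith)] at h1
  have h2 : |((⌊x⌋ - ⌊y⌋ : ℤ) : ℚ) - (2 * T + 1) / m| ≤ 1 := by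
    rw [← hxy, abs_le]
    push_cast
    have := Int.floor_le x
    have := Int.lt_floor_add_one x
    have := Int.floor_le y
    have := Int.lt_floor_add_one y
    constructor <;> linarith
  rw [← h1] at h2
  have h3 := (Rat.cast_le (K := ℝ)).2 h2
  simpa using h3

theorem tendsto_one_div_two_mul_add_one :
    Tendsto (fun T : ℕ => (1 : ℝ) / (2 * T + 1)) atTop (𝓝 0) := by
  refine Tendsto.div_atTop tendsto_const_nhds ?_
  exact tendsto_atTop_add_const_right _ _
    (tendsto_natCast_atTop_atTop.const_mul_atTop two_pos)

theorem tendsto_card_modEq (m : ℕ) (hm : 0 < m) (v : ℤ) :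
    Tendsto (fun T : ℕ => (((Finset.Icc (-(T : ℤ)) T).filter (fun x => x ≡ v [ZMOD m])).card : ℝ) /
      (2 * T + 1)) atTop (𝓝 (1 / m)) := by
  refine tendsto_iff_norm_sub_tendsto_zero.2 (squeeze_zero (fun _ => norm_nonneg _) (fun T => ?_)
    tendsto_one_div_two_mul_add_one)
  have hT : (0 : ℝ) < 2 * T + 1 := by positivity
  have hm' : (0 : ℝ) < m := by exact_mod_cast hm
  have h1 := abs_card_modEq_sub_le m hm v T
  rw [Real.norm_eq_abs, le_div_iff₀ hT]
  nth_rewrite 2 [← abs_of_pos hT]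
  rw [← abs_mul, sub_mul, div_mul_cancel₀ _ hT.ne', one_div_mul_eq_div]
  exact h1

/-- A set of pairs of integers that is a union of residue classes has a density. -/
theorem hasNaturalDensity_of_periodic {E : Set (ℤ × ℤ)} {m : ℕ} (hm : 0 < m)
    (hE : ∀ Q Q' : ℤ × ℤ, Q.1 ≡ Q'.1 [ZMOD m] → Q.2 ≡ Q'.2 [ZMOD m] → Q ∈ E → Q' ∈ E) :
    ∃ δ, HasNaturalDensity E δ := by
  classical
  set R : Finset (ℤ × ℤ) := (Finset.Ico 0 (m : ℤ) ×ˢ Finset.Ico 0 (m : ℤ)).filter (· ∈ E) with hR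
  have hm' : (m : ℤ) ≠ 0 := by exact_mod_cast hm.ne'
  have hm'' : (0 : ℤ) < m := by exact_mod_cast hm
  have hcard : ∀ T : ℕ, (E ∩ box T).ncard = ∑ r ∈ R,
      ((Finset.Icc (-(T : ℤ)) T).filter (fun x => x ≡ r.1 [ZMOD m])).card *
      ((Finset.Icc (-(T : ℤ)) T).filter (fun x => x ≡ r.2 [ZMOD m])).card := by
    intro T
    have h1 : E ∩ box T = (((Finset.Icc (-(T : ℤ)) T) ×ˢ (Finset.Icc (-(T : ℤ)) T)).filter (· ∈ E) :
        Finset (ℤ × ℤ)) := by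
      ext Q
      simp only [Set.mem_inter_iff, mem_box, Finset.coe_filter, Set.mem_ofPred_eq,
        Finset.mem_product, Finset.mem_Icc]
      tauto
    rw [h1, Set.ncard_coe_finset]
    rw [Finset.card_eq_sum_card_fiberwise (f := fun Q : ℤ × ℤ => (Q.1 % m, Q.2 % m)) (t := R)]
    · refine Finset.sum_congr rfl fun r hr => ?_
      rw [← Finset.card_product]
      congr 1
      ext Q
      simp only [hR, Finset.mem_filter, Finset.mem_product, Finset.mem_Icc, Finset.mem_Ico] at hr ⊢
      have e1 : r.1 % m = r.1 := Int.emod_eq_of_lt hr.1.1.1 hr.1.1.2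
      have e2 : r.2 % m = r.2 := Int.emod_eq_of_lt hr.1.2.1 hr.1.2.2
      simp only [Int.ModEq, e1, e2, Prod.ext_iff]
      constructor
      · tauto
      · rintro ⟨⟨h3, h4⟩, h5, h6⟩
        exact ⟨⟨⟨h3, h5⟩, hE r Q (by rw [Int.ModEq, e1, h4]) (by rw [Int.ModEq, e2, h6]) hr.2⟩, h4, h6⟩
    · intro Q hQ
      simp only [Finset.coe_filter, Set.mem_ofPred_eq] at hQ
      simp only [hR, Finset.coe_filter, Set.mem_ofPred_eq, Finset.mem_product, Finset.mem_Ico]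
      exact ⟨⟨⟨Int.emod_nonneg _ hm', Int.emod_lt_of_pos _ hm''⟩, Int.emod_nonneg _ hm',
        Int.emod_lt_of_pos _ hm''⟩, hE Q _ (Int.mod_modEq _ _).symm (Int.mod_modEq _ _).symm hQ.2⟩
  refine ⟨∑ r ∈ R, 1 / (m : ℝ) * (1 / m), ?_⟩
  refine (tendsto_finsetSum R fun r _ =>
    (tendsto_card_modEq m hm r.1).mul (tendsto_card_modEq m hm r.2)).congr fun T => ?_
  change _ = ((E ∩ box T).ncard : ℝ) / _
  rw [hcard, Nat.cast_sum, Finset.sum_div]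
  refine Finset.sum_congr rfl fun r _ => ?_
  push_cast
  rw [div_mul_div_comm, pow_two]

/-- A real sequence converges if it is approximated, up to any `ε`, by convergent sequences. -/
theorem exists_tendsto_of_approx {a : ℕ → ℝ}
    (h : ∀ ε > 0, ∃ (b : ℕ → ℝ) (l : ℝ), Tendsto b atTop (𝓝 l) ∧ ∀ᶠ T in atTop, |a T - b T| ≤ ε) :
    ∃ δ, Tendsto a atTop (𝓝 δ) := by
  refine cauchySeq_tendsto_of_complete (Metric.cauchySeq_iff'.2 fun ε hε => ?_)
  obtain ⟨b, l, hb, hab⟩ := h (ε / 5) (by positivity)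
  obtain ⟨N, hN⟩ := eventually_atTop.1 (hab.and (Metric.tendsto_nhds.1 hb (ε / 5) (by positivity)))
  refine ⟨N, fun k hk => ?_⟩
  obtain ⟨h1, h2⟩ := hN k hk
  obtain ⟨h3, h4⟩ := hN N le_rfl
  rw [Real.dist_eq] at h2 h4 ⊢
  rw [abs_le] at h1 h3
  rw [abs_lt] at h2 h4 ⊢
  constructor <;> linarith

theorem ncard_dvd_inter_box_le (q : ℕ) (hq : 0 < q) (T : ℕ) :
    (({Q : ℤ × ℤ | (q : ℤ) ∣ Q.1} ∩ box T).ncard : ℝ) / (2 * (T : ℝ) + 1) ^ 2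
      ≤ 1 / q + 1 / (2 * T + 1) ∧
    (({Q : ℤ × ℤ | (q : ℤ) ∣ Q.2} ∩ box T).ncard : ℝ) / (2 * (T : ℝ) + 1) ^ 2
      ≤ 1 / q + 1 / (2 * T + 1) := by
  classical
  set S := (Finset.Icc (-(T : ℤ)) T).filter (fun x => x ≡ 0 [ZMOD q]) with hS
  have hT : (0 : ℝ) < 2 * T + 1 := by positivity
  have hI : ((Finset.Icc (-(T : ℤ)) T).card : ℝ) = 2 * T + 1 := by
    rw [Int.card_Icc]
    have : (T : ℤ) + 1 - -(T : ℤ) = ((2 * T + 1 : ℕ) : ℤ) := by push_cast; ring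
    rw [this, Int.toNat_natCast]
    push_cast; ring
  have h1 : {Q : ℤ × ℤ | (q : ℤ) ∣ Q.1} ∩ box T = (S ×ˢ Finset.Icc (-(T : ℤ)) T : Finset (ℤ × ℤ)) := by
    ext Q; simp [hS, mem_box, Int.modEq_zero_iff_dvd]; tauto
  have h2 : {Q : ℤ × ℤ | (q : ℤ) ∣ Q.2} ∩ box T = (Finset.Icc (-(T : ℤ)) T ×ˢ S : Finset (ℤ × ℤ)) := by
    ext Q; simp [hS, mem_box, Int.modEq_zero_iff_dvd]; tauto
  have h3 : (S.card : ℝ) ≤ (2 * T + 1) / q + 1 := by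
    have := (abs_le.1 (abs_card_modEq_sub_le q hq 0 T)).2
    linarith
  have h4 : (S.card : ℝ) * (2 * T + 1) / (2 * (T : ℝ) + 1) ^ 2 ≤ 1 / q + 1 / (2 * T + 1) := by
    rw [pow_two, mul_div_mul_right _ _ hT.ne', div_le_iff₀ hT]
    refine h3.trans (le_of_eq ?_)
    field_simp
  rw [h1, h2, Set.ncard_coe_finset, Set.ncard_coe_finset, Finset.card_product, Finset.card_product]
  push_cast
  rw [hI]
  exact ⟨h4, by rw [mul_comm (2 * (T : ℝ) + 1)]; exact h4⟩

theorem padicValInt_congr {p K : ℕ} (hp : p.Prime) {a b : ℤ} (h : (p : ℤ) ^ K ∣ a - b)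
    (ha : ¬ (p : ℤ) ^ K ∣ a) :
    a ≠ 0 ∧ b ≠ 0 ∧ ¬ (p : ℤ) ^ K ∣ b ∧ padicValInt p a = padicValInt p b := by
  have hb : ¬ (p : ℤ) ^ K ∣ b := fun hb => ha ((dvd_sub_left hb).1 h)
  have ha0 : a ≠ 0 := by rintro rfl; exact ha (dvd_zero _)
  have hb0 : b ≠ 0 := by rintro rfl; exact hb (dvd_zero _)
  refine ⟨ha0, hb0, hb, ?_⟩
  have key : ∀ j ≤ K, ((p : ℤ) ^ j ∣ a ↔ (p : ℤ) ^ j ∣ b) := fun j hj =>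
    dvd_iff_dvd_of_dvd_sub ((pow_dvd_pow _ hj).trans h)
  rw [pow_dvd_iff_le_padicValInt hp ha0] at ha
  rw [pow_dvd_iff_le_padicValInt hp hb0] at hb
  refine le_antisymm ?_ ?_
  · rw [← pow_dvd_iff_le_padicValInt hp hb0, ← key _ (by omega),
      pow_dvd_iff_le_padicValInt hp ha0]
  · rw [← pow_dvd_iff_le_padicValInt hp ha0, key _ (by omega),
      pow_dvd_iff_le_padicValInt hp hb0]

theorem exists_pow_dvd_of_mem_excluded {n : ℕ} (hn : n ≠ 0) {Q : ℤ × ℤ} (hQ : Q ∈ Excluded n) :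
    ∃ p ∈ n.primeFactors, ((p ^ ((p + 1) / 2) : ℕ) : ℤ) ∣ Q.1 := by
  obtain ⟨h1, h2, p, hp, hpn, -, heven, hodd⟩ := hQ
  refine ⟨p, Nat.mem_primeFactors.2 ⟨hp, hpn, hn⟩, ?_⟩
  rw [Nat.cast_pow, pow_dvd_iff_le_padicValInt hp h1, padicValInt_eq_sqPart h1 hp]
  have hle := Nat.le_of_dvd (Nat.pos_of_ne_zero hn) hpn
  have h3 : (n : ℚ) ≤ 2 * padicValNat p (sqPart Q.1) := by
    have h4 : (0 : ℚ) ≤ (padicValInt p Q.2 : ℚ) := by positivity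
    have h5 : (0 : ℚ) ≤ n := by positivity
    rcases Nat.even_or_odd (padicValInt p Q.2) with h | h
    · have := heven h; linarith
    · have := hodd h; linarith
  have h4 : n ≤ 2 * padicValNat p (sqPart Q.1) := by exact_mod_cast h3
  have := hp.two_le
  omega

/-- Away from the pairs divisible by a high power of a prime `p ∣ n`, the excluded set is a union of
residue classes. -/
theorem hasNaturalDensity_excluded_inter {n : ℕ} (hn : 2 ≤ n) (K : ℕ) :
    ∃ δ, HasNaturalDensity (Excluded n ∩
      {Q | ∀ p ∈ n.primeFactors, ¬ (p : ℤ) ^ K ∣ Q.1 ∧ ¬ (p : ℤ) ^ K ∣ Q.2}) δ := by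
  refine hasNaturalDensity_of_periodic (m := n ^ K) (by positivity) ?_
  rintro ⟨B, C⟩ ⟨B', C'⟩ h1 h2 ⟨hE, hK⟩
  simp only at h1 h2
  have key : ∀ p ∈ n.primeFactors, (B' ≠ 0 ∧ ¬ (p : ℤ) ^ K ∣ B' ∧ padicValInt p B = padicValInt p B') ∧
      (C' ≠ 0 ∧ ¬ (p : ℤ) ^ K ∣ C' ∧ padicValInt p C = padicValInt p C') := by
    intro p hp
    have hp' := Nat.prime_of_mem_primeFactors hp
    have hpn : (p : ℤ) ^ K ∣ ((n ^ K : ℕ) : ℤ) := by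
      exact_mod_cast pow_dvd_pow_of_dvd (Nat.dvd_of_mem_primeFactors hp) K
    exact ⟨(padicValInt_congr hp' (hpn.trans h1.symm.dvd) (hK p hp).1).2,
      (padicValInt_congr hp' (hpn.trans h2.symm.dvd) (hK p hp).2).2⟩
  obtain ⟨hB0, hC0, p, hp, hpn, hrest⟩ := hE
  have hk := key p (Nat.mem_primeFactors.2 ⟨hp, hpn, by omega⟩)
  refine ⟨⟨hk.1.1, hk.2.1, p, hp, hpn, ?_⟩, fun q hq => ⟨(key q hq).1.2.1, (key q hq).2.2.1⟩⟩
  simp only at hrest ⊢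
  rw [padicValNat_sqPart hk.1.1 hp, ← hk.1.2.2, ← hk.2.2.2]
  rwa [padicValNat_sqPart hB0 hp] at hrest

theorem exists_hasNaturalDensity_excluded {n : ℕ} (hn : 2 ≤ n) :
    ∃ δ, HasNaturalDensity (Excluded n) δ := by
  refine exists_tendsto_of_approx fun ε hε => ?_
  set c : ℝ := 2 * (n.primeFactors.card : ℝ) with hc
  have hc0 : 0 ≤ c := by positivity
  obtain ⟨K, hK⟩ : ∃ K : ℕ, c * (1 / 2) ^ K ≤ ε / 2 := by
    have h1 : Tendsto (fun K : ℕ => c * (1 / 2 : ℝ) ^ K) atTop (𝓝 (c * 0)) :=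
      (tendsto_pow_atTop_nhds_zero_of_lt_one (by norm_num) (by norm_num)).const_mul c
    rw [mul_zero] at h1
    exact (h1.eventually_le_const (by positivity)).exists
  obtain ⟨l, hl⟩ := hasNaturalDensity_excluded_inter hn K
  set G : Set (ℤ × ℤ) := {Q | ∀ p ∈ n.primeFactors, ¬ (p : ℤ) ^ K ∣ Q.1 ∧ ¬ (p : ℤ) ^ K ∣ Q.2} with hG
  refine ⟨_, l, hl, ?_⟩
  have h2 : Tendsto (fun T : ℕ => c * ((1 : ℝ) / (2 * T + 1))) atTop (𝓝 (c * 0)) :=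
    tendsto_one_div_two_mul_add_one.const_mul c
  rw [mul_zero] at h2
  filter_upwards [h2.eventually_le_const (by positivity : (0 : ℝ) < ε / 2)] with T hT
  change |((Excluded n ∩ box T).ncard : ℝ) / _ - ((Excluded n ∩ G ∩ box T).ncard : ℝ) / _| ≤ ε
  have hT0 : (0 : ℝ) < (2 * (T : ℝ) + 1) ^ 2 := by positivity
  have hsub : Excluded n ∩ box T ⊆ (Excluded n ∩ G ∩ box T) ∪ ⋃ p ∈ n.primeFactors,
      (({Q : ℤ × ℤ | ((p ^ K : ℕ) : ℤ) ∣ Q.1} ∩ box T) ∪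
        ({Q : ℤ × ℤ | ((p ^ K : ℕ) : ℤ) ∣ Q.2} ∩ box T)) := by
    rintro Q ⟨hQ, hQT⟩
    by_cases hQG : Q ∈ G
    · exact Or.inl ⟨⟨hQ, hQG⟩, hQT⟩
    · right
      have h3 : ∃ p ∈ n.primeFactors, (p : ℤ) ^ K ∣ Q.1 ∨ (p : ℤ) ^ K ∣ Q.2 := by
        by_contra! h
        exact hQG h
      obtain ⟨p, hp, h⟩ := h3
      refine Set.mem_biUnion hp ?_
      rcases h with h | h
      · exact Or.inl ⟨by simpa using h, hQT⟩
      · exact Or.inr ⟨by simpa using h, hQT⟩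
  have hfin : ((Excluded n ∩ G ∩ box T) ∪ ⋃ p ∈ n.primeFactors,
      (({Q : ℤ × ℤ | ((p ^ K : ℕ) : ℤ) ∣ Q.1} ∩ box T) ∪
        ({Q : ℤ × ℤ | ((p ^ K : ℕ) : ℤ) ∣ Q.2} ∩ box T))).Finite :=
    (box_finite T).subset (Set.union_subset Set.inter_subset_right
      (Set.iUnion₂_subset fun _ _ => Set.union_subset Set.inter_subset_right Set.inter_subset_right))
  have h3 : ((Excluded n ∩ box T).ncard : ℝ) ≤ (Excluded n ∩ G ∩ box T).ncard +
      ∑ p ∈ n.primeFactors, ((({Q : ℤ × ℤ | ((p ^ K : ℕ) : ℤ) ∣ Q.1} ∩ box T).ncard : ℝ) +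
        ({Q : ℤ × ℤ | ((p ^ K : ℕ) : ℤ) ∣ Q.2} ∩ box T).ncard) := by
    have := (Set.ncard_le_ncard hsub hfin).trans ((Set.ncard_union_le _ _).trans
      (Nat.add_le_add_left ((Finset.set_ncard_biUnion_le _ _).trans
        (Finset.sum_le_sum fun p _ => Set.ncard_union_le _ _)) _))
    exact_mod_cast this
  have h4 : ((Excluded n ∩ G ∩ box T).ncard : ℝ) ≤ (Excluded n ∩ box T).ncard := by
    exact_mod_cast Set.ncard_le_ncard
      (show Excluded n ∩ G ∩ box T ⊆ Excluded n ∩ box T from fun Q hQ => ⟨hQ.1.1, hQ.2⟩)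
      ((box_finite T).subset Set.inter_subset_right)
  have h5 : (∑ p ∈ n.primeFactors, ((({Q : ℤ × ℤ | ((p ^ K : ℕ) : ℤ) ∣ Q.1} ∩ box T).ncard : ℝ) +
        ({Q : ℤ × ℤ | ((p ^ K : ℕ) : ℤ) ∣ Q.2} ∩ box T).ncard)) / (2 * (T : ℝ) + 1) ^ 2 ≤ ε := by
    rw [Finset.sum_div]
    calc _ ≤ ∑ p ∈ n.primeFactors, 2 * ((1 / 2 : ℝ) ^ K + 1 / (2 * T + 1)) := by
          refine Finset.sum_le_sum fun p hp => ?_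
          have hp' := Nat.prime_of_mem_primeFactors hp
          obtain ⟨h6, h7⟩ := ncard_dvd_inter_box_le (p ^ K) (pow_pos hp'.pos K) T
          have h8 : (1 : ℝ) / ((p ^ K : ℕ) : ℝ) ≤ (1 / 2) ^ K := by
            rw [one_div_pow, Nat.cast_pow]
            refine one_div_le_one_div_of_le (by positivity) ?_
            exact pow_le_pow_left₀ (by norm_num) (by exact_mod_cast hp'.two_le) K
          rw [add_div]
          linarith
      _ = c * (1 / 2) ^ K + c * (1 / (2 * T + 1)) := by
          rw [Finset.sum_const, nsmul_eq_mul, hc]; ring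
      _ ≤ ε := by linarith
  rw [← sub_div, abs_of_nonneg (div_nonneg (by linarith) hT0.le)]
  refine le_trans ?_ h5
  gcongr
  linarith

theorem density_excluded_le {n : ℕ} (hn : n ≠ 0) {δ : ℝ} (h : HasNaturalDensity (Excluded n) δ) :
    δ ≤ ∑ p ∈ n.primeFactors, 1 / (p : ℝ) ^ ((p + 1) / 2) := by
  have h1 : Tendsto (fun T : ℕ => ∑ p ∈ n.primeFactors,
      (1 / (p : ℝ) ^ ((p + 1) / 2) + 1 / (2 * (T : ℝ) + 1))) atTop
      (𝓝 (∑ p ∈ n.primeFactors, (1 / (p : ℝ) ^ ((p + 1) / 2) + 0))) :=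
    tendsto_finsetSum _ fun p _ => tendsto_const_nhds.add tendsto_one_div_two_mul_add_one
  simp only [add_zero] at h1
  refine le_of_tendsto_of_tendsto' h h1 fun T => ?_
  change ((Excluded n ∩ box T).ncard : ℝ) / _ ≤ _
  have hsub : Excluded n ∩ box T ⊆ ⋃ p ∈ n.primeFactors,
      ({Q : ℤ × ℤ | ((p ^ ((p + 1) / 2) : ℕ) : ℤ) ∣ Q.1} ∩ box T) := by
    rintro Q ⟨hQ, hQT⟩
    obtain ⟨p, hp, hpQ⟩ := exists_pow_dvd_of_mem_excluded hn hQ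
    exact Set.mem_biUnion hp ⟨hpQ, hQT⟩
  have hfin : (⋃ p ∈ n.primeFactors,
      ({Q : ℤ × ℤ | ((p ^ ((p + 1) / 2) : ℕ) : ℤ) ∣ Q.1} ∩ box T)).Finite :=
    (box_finite T).subset (Set.iUnion₂_subset fun _ _ => Set.inter_subset_right)
  have h2 : ((Excluded n ∩ box T).ncard : ℝ) ≤ ∑ p ∈ n.primeFactors,
      (({Q : ℤ × ℤ | ((p ^ ((p + 1) / 2) : ℕ) : ℤ) ∣ Q.1} ∩ box T).ncard : ℝ) := by
    exact_mod_cast (Set.ncard_le_ncard hsub hfin).trans (Finset.set_ncard_biUnion_le _ _)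
  refine (div_le_div_of_nonneg_right h2 (by positivity)).trans ?_
  rw [Finset.sum_div]
  refine Finset.sum_le_sum fun p hp => ?_
  have hp' := Nat.prime_of_mem_primeFactors hp
  exact_mod_cast (ncard_dvd_inter_box_le (p ^ ((p + 1) / 2)) (pow_pos hp'.pos _) T).1

/-! ### Excluded and borderline pairs after the reduction -/

section

variable {n : ℕ} {B C : ℤ} {p : ℕ}

theorem padicValNat_sqPart_eq_add (hB : B ≠ 0) (hp : p.Prime) :
    padicValNat p (sqPart B) = padicValNat p (commonSq B C) + padicValNat p (sqPart (redB B C)) := by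
  have := Fact.mk hp
  rw [sqPart_eq_commonSq_mul (C := C) hB,
    padicValNat.mul (commonSq_ne_zero hB) (sqPart_pos (redB_ne_zero hB)).ne']

theorem padicValInt_eq_add (hB : B ≠ 0) (hC : C ≠ 0) (hp : p.Prime) :
    padicValInt p C = 2 * padicValNat p (commonSq B C) + padicValInt p (redC B C) := by
  have := Fact.mk hp
  have hg : (commonSq B C : ℤ) ≠ 0 := by exact_mod_cast commonSq_ne_zero hB
  conv_lhs => rw [← commonSq_sq_mul_redC (B := B) (C := C)]
  rw [padicValInt.mul (pow_ne_zero 2 hg) (redC_ne_zero hC), pow_two, padicValInt.mul hg hg,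
    padicValInt.of_nat]
  ring

theorem padicValNat_lt_of_not_mem_excluded (hB : B ≠ 0) (hC : C ≠ 0) (hn : 0 < n)
    (hE : (B, C) ∉ Excluded n) (hp : p.Prime) (hpn : p ∣ n) (hc : padicValInt p (redC B C) = 0) :
    padicValNat p (sqPart (redB B C)) < n := by
  by_contra! h
  refine hE ⟨hB, hC, p, hp, hpn, ?_⟩
  simp only
  rw [padicValNat_sqPart_eq_add (C := C) hB hp, padicValInt_eq_add hB hC hp, hc]
  have h1 : (n : ℚ) ≤ padicValNat p (sqPart (redB B C)) := by exact_mod_cast h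
  have h2 : (0 : ℚ) < n := by exact_mod_cast hn
  push_cast
  refine ⟨by linarith, fun _ => by linarith, fun h => ?_⟩
  obtain ⟨k, hk⟩ := h
  omega

theorem padicValNat_le_of_not_mem_excluded (hB : B ≠ 0) (hC : C ≠ 0) (hn : Odd n)
    (hE : (B, C) ∉ Excluded n) (hp : p.Prime) (hpn : p ∣ n) (hc : padicValInt p (redC B C) = 1) :
    2 * padicValNat p (sqPart (redB B C)) ≤ n + 1 := by
  by_contra! h
  refine hE ⟨hB, hC, p, hp, hpn, ?_⟩
  simp only
  rw [padicValNat_sqPart_eq_add (C := C) hB hp, padicValInt_eq_add hB hC hp, hc]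
  have h0 : n + 3 ≤ 2 * padicValNat p (sqPart (redB B C)) := by
    obtain ⟨m, hm⟩ := hn
    omega
  have h1 : (n : ℚ) + 3 ≤ 2 * padicValNat p (sqPart (redB B C)) := by exact_mod_cast h0
  have h2 : (0 : ℚ) ≤ n := by positivity
  push_cast
  refine ⟨by linarith, fun h => ?_, fun _ => by linarith⟩
  obtain ⟨k, hk⟩ := h
  omega

end

end GenFermat

theorem theoremB (n : ℕ) (hn : Odd n) (hn3 : 3 ≤ n) :
    (∃ δ : ℝ, GenFermat.HasNaturalDensity (GenFermat.Excluded n) δ ∧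
      δ ≤ ∑ p ∈ n.primeFactors, 1 / (p : ℝ) ^ ((p + 1) / 2)) ∧
    ∀ B C : ℤ, B ≠ 0 → C ≠ 0 → ¬ IsSquare (-B) → (B, C) ∉ GenFermat.Excluded n →
      (GenFermat.cascadePairs n B C).Finite ∧
      (∀ D ∈ GenFermat.Data n B C,
        (GenFermat.targetPair n B C D).1 ≠ 0 ∧ (GenFermat.targetPair n B C D).2 ≠ 0 ∧
        GenFermat.sqfPart (GenFermat.targetPair n B C D).1 = GenFermat.sqfPart B ∧
        Int.gcd (GenFermat.sqPart (GenFermat.targetPair n B C D).1)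
          (GenFermat.targetPair n B C D).2 = 1) ∧
      ((GenFermat.Points n B C).Nonempty ↔
        ∃ Q ∈ GenFermat.cascadePairs n B C, (GenFermat.cascadeSet n B C Q).Nonempty) ∧
      (¬ GenFermat.Borderline n B C → ∀ D ∈ GenFermat.Data n B C,
        ((GenFermat.datumPoints n B C D).Nonempty ↔
          ∀ M : ℕ, GenFermat.AllowedModulus (GenFermat.targetPair n B C D).1
              (GenFermat.targetPair n B C D).2 D.2 M →
            (GenFermat.BasePoints n (GenFermat.targetPair n B C D).1
              (GenFermat.targetPair n B C D).2 D.2 1 M).Nonempty)) := by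
  refine ⟨?_, fun B C hB hC hsq hE => ⟨?_, ?_, ?_, ?_⟩⟩
  · obtain ⟨δ, hδ⟩ := GenFermat.exists_hasNaturalDensity_excluded (n := n) (by omega)
    exact ⟨δ, hδ, GenFermat.density_excluded_le (by omega) hδ⟩
  all_goals
    have hB₁ := GenFermat.redB_ne_zero (C := C) hB
    have hC₁ := GenFermat.redC_ne_zero (B := B) hC
    have hred := fun (p : ℕ) (hp : p.Prime) => GenFermat.not_sq_dvd_redB_redC (C := C) hB hp
    have hsq₁ := GenFermat.not_isSquare_neg_redB (C := C) hsq
  · exact (GenFermat.redData_finite hB₁ hC₁).image _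
  · rintro ⟨d, κ⟩ ⟨hd, hL, -⟩
    exact ⟨GenFermat.newB_ne_zero hB₁ hd.ne' hL, GenFermat.newC_ne_zero hn.pos hB₁ hC₁ hd.ne' hL,
      (GenFermat.sqfPart_newB hB₁ hd.ne' hL).trans (GenFermat.sqfPart_redB hB),
      GenFermat.gcd_sqPart_newB_newC hn.pos hB₁ hC₁ hred hd.ne' hL⟩
  · rw [← GenFermat.points_redB_redC_nonempty_iff (by omega) hB]
    constructor
    · intro h
      obtain ⟨D, hD, P, hP⟩ :=
        GenFermat.exists_basePoints_of_points (by omega) hB₁ hC₁ hsq₁ hred h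
      exact ⟨_, ⟨D, hD, rfl⟩, P, D, hD, rfl, hP⟩
    · rintro ⟨Q, -, P, D, hD, -, hP⟩
      exact GenFermat.points_nonempty_of_basePoints hn.pos hB₁ hC₁ hD.1.ne' hD.2.1 ⟨P, hP⟩
  · rintro hbor ⟨d, κ⟩ ⟨hd, hL, hκ⟩
    refine GenFermat.basePoints_nonempty_iff hn hn3 hB₁ hC₁ hsq₁ hd.ne' hL hκ
      fun p hp hpy hpB hpn => ?_
    refine GenFermat.dvd_newC_of_dvd_yMod hn hB₁ hC₁ hred hd.ne' hL hp hpy hpB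
      (GenFermat.padicValNat_lt_of_not_mem_excluded hB hC hn.pos hE hp hpn)
      (GenFermat.padicValNat_le_of_not_mem_excluded hB hC hn hE hp hpn) fun hp₀ heq => ?_
    refine hbor ⟨p, hp, hpn, (GenFermat.sqfPart_redB (C := C) hB) ▸ hp₀, ?_⟩
    rw [GenFermat.padicValNat_sqPart_eq_add (C := C) hB hp, GenFermat.padicValInt_eq_add hB hC hp]
    omega
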